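/- Let $\Gamma=(m_{i,j})_{i,j\in I}$ be a Coxeter matrix over an arbitrary (possibly infinite) set $I$, with entries in $\mathbb N_{\ge 1}\cup\{\infty\}$. Let $W$ be its Coxeter group with simple reflections $s_i$ and standard length $\ell$, and let $B^+_\Gamma$ be its positive Artin–Tits monoid, i.e. the monoid generated by the $\mathbf s_i$ ($i\in I$) subject to the braid relations $\mathbf s_i\mathbf s_j\mathbf s_i\cdots=\mathbf s_j\mathbf s_i\mathbf s_j\cdots$ ($m_{i,j}$ factors on each side) for all $i,j$ with $m_{i,j}\ne\infty$. For $\alpha\subseteq I$ let $W_\alpha=\langle s_i\mid i\in\alpha\rangle$; if $W_\alpha$ is finite, let $r_\alpha$ be its unique element of maximal length, and let $\mathbf r_\alpha\in B^+_\Gamma$ be the element $\mathbf s_{i_1}\cdots\mathbf s_{i_n}$, where $s_{i_1}\cdots s_{i_n}$ is any reduced expression of $r_\alpha$. Let $\tilde I$ be an admissible partition of $\Gamma$: a partition of $I$ such that $W_\alpha$ is finite for every $\alpha\in\tilde I$ and such that, for every $w$ in the subgroup $\langle r_\beta\mid\beta\in\tilde I\rangle$ of $W$ and every $\alpha\in\tilde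 I$, either $\ell(ws_i)=\ell(w)+1$ for all $i\in\alpha$, or $\ell(ws_i)=\ell(w)-1$ for all $i\in\alpha$. Let $\tilde\Gamma=(|r_\alpha r_\beta|)_{\alpha,\beta\in\tilde I}$, the matrix of the orders of the products $r_\alpha r_\beta$ in $W$, be its type. Then $\tilde\Gamma$ is a Coxeter matrix, and, writing $B^+_{\tilde\Gamma}$ for the positive Artin–Tits monoid of $\tilde\Gamma$, with generators $\mathbf s_\alpha$ ($\alpha\in\tilde I$): 1. The map $\mathbf s_\alpha\mapsto\mathbf r_\alpha$ extends to a monoid morphism $\varphi:B^+_{\tilde\Gamma}\to B^+_\Gamma$. 2. The morphism $\varphi$ respects lcm's and is injective. Here $\varphi$ respects right lcm's if $\varphi(\mathbf s_\alpha)\neq 1$ for all $\alpha\in\tilde I$ and if, for all $\alpha,\beta\in\tilde I$, the elements $\mathbf s_\alpha,\mathbf s_\beta$ have a right lcm (a least common multiple for left divisibility) in $B^+_{\tilde\Gamma}$ if and only if $\varphi(\mathbf s_\alpha),\varphi(\mathbf s_\beta)$ have a right lcm in $B^+_\Gamma$, in which case the latter is the image under $\varphi$ of the former; respecting left lcm's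 is defined symmetrically, and $\varphi$ respects lcm's if it respects both right and left lcm's. In particular, let $\tilde{\mathbf S}=\{\mathbf r_\alpha\mid\alpha\in\tilde I\}$ and let $\tilde B^+$ be the submonoid of $B^+_\Gamma$ generated by $\tilde{\mathbf S}$. Then $\varphi$ induces an isomorphism from $B^+_{\tilde\Gamma}$ onto $\tilde B^+$ that maps $\{\mathbf s_\alpha\mid\alpha\in\tilde I\}$ onto $\tilde{\mathbf S}$; that is, $(\tilde B^+,\tilde{\mathbf S})$ is isomorphic to the positive Artin–Tits system of type $\tilde\Gamma$. -/

import Mathlib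

namespace CoxeterMatrix

universe u v

/-- The alternating product `x * y * x * ⋯` with `n` factors, starting with `x`. -/
def altProd {N : Type u} [Monoid N] : ℕ → N → N → N
  | 0, _, _ => 1
  | n + 1, x, y => x * altProd n y x

/-- The braid relations between words over `I`. The entry `0` of a Coxeter matrix stands
for `∞`, so that there is no relation for such a pair. -/
def BraidRel {I : Type u} (M : CoxeterMatrix I) (x y : FreeMonoid I) : Prop :=
  ∃ i j : I, M i j ≠ 0 ∧
    x = altProd (M i j) (FreeMonoid.of i) (FreeMonoid.of j) ∧
    y = altProd (M i j) (FreeMonoid.of j) (FreeMonoid.of i)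

/-- The positive Artin-Tits monoid of a Coxeter matrix, given by its presentation. -/
abbrev ArtinMonoid {I : Type u} (M : CoxeterMatrix I) : Type u :=
  PresentedMonoid M.BraidRel

/-- The standard generator of the Artin-Tits monoid with index `i`. -/
def artinGen {I : Type u} (M : CoxeterMatrix I) (i : I) : M.ArtinMonoid :=
  PresentedMonoid.of M.BraidRel i

/-- The standard length on the Coxeter group. -/
noncomputable def len {I : Type u} (M : CoxeterMatrix I) (w : M.Group) : ℕ :=
  M.toCoxeterSystem.length w

/-- The image in the Artin-Tits monoid of an element `w` of the Coxeter group: the product,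
in the monoid, of a reduced word of `w`. Two reduced words of `w` differ by braid relations,
so that the result does not depend on the word. -/
noncomputable def simpleLift {I : Type u} (M : CoxeterMatrix I) (w : M.Group) :
    M.ArtinMonoid :=
  ((M.toCoxeterSystem.exists_isReduced w).choose.map M.artinGen).prod

/-- The standard parabolic subgroup `W_J`. -/
def parabolic {I : Type u} (M : CoxeterMatrix I) (J : Set I) : Subgroup M.Group :=
  Subgroup.closure (M.simple '' J)

/-- A subset `J` of the index set is spherical if `W_J` is finite. -/
def IsSpherical {I : Type u} (M : CoxeterMatrix I) (J : Set I) : Prop :=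
  Finite (M.parabolic J)

/-- `w` is an element of maximal standard length in `W_J`. -/
def IsLongestIn {I : Type u} (M : CoxeterMatrix I) (J : Set I) (w : M.Group) : Prop :=
  w ∈ M.parabolic J ∧ ∀ v ∈ M.parabolic J, M.len v ≤ M.len w

/-- The element `r_J` of maximal standard length in `W_J`, for a spherical `J` (it is unique
in that case). For other `J` the value is irrelevant. -/
noncomputable def longest {I : Type u} (M : CoxeterMatrix I) (J : Set I) : M.Group :=
  Classical.epsilon (M.IsLongestIn J)

theorem isLongestIn_longest {I : Type u} (M : CoxeterMatrix I) {J : Set I}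
    (h : M.IsSpherical J) : M.IsLongestIn J (M.longest J) := by
  apply Classical.epsilon_spec (p := M.IsLongestIn J)
  have : Finite (M.parabolic J) := h
  obtain ⟨w, hw⟩ := Finite.exists_max (fun w : M.parabolic J => M.len w)
  exact ⟨w, w.2, fun v hv => hw ⟨v, hv⟩⟩

/-- `I⁺(w)`: the indices `i` with `ℓ(w sᵢ) = ℓ(w) + 1`. -/
def ascents {I : Type u} (M : CoxeterMatrix I) (w : M.Group) : Set I :=
  {i | M.len (w * M.simple i) = M.len w + 1}

/-- `I⁻(w)`: the indices `i` with `ℓ(w sᵢ) = ℓ(w) - 1`, written without subtraction. -/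
def descents {I : Type u} (M : CoxeterMatrix I) (w : M.Group) : Set I :=
  {i | M.len (w * M.simple i) + 1 = M.len w}

/-- Admissible partitions of the index set (the parts of a partition are non-empty, pairwise
disjoint and cover the index set). -/
structure IsAdmissible {I : Type u} (M : CoxeterMatrix I) (P : Set (Set I)) : Prop where
  isPartition : Setoid.IsPartition P
  isSpherical : ∀ α ∈ P, M.IsSpherical α
  ascents_or_descents : ∀ w ∈ Subgroup.closure (M.longest '' P), ∀ α ∈ P,
    α ⊆ M.ascents w ∨ α ⊆ M.descents w

/-- `N` is the type of the partition `P`: the Coxeter matrix of the orders of the products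
`r_α r_β`. Infinite order is recorded as `0` by `orderOf`, as in a Coxeter matrix. -/
def IsTypeOf {I : Type u} (M : CoxeterMatrix I) (P : Set (Set I)) (N : CoxeterMatrix P) :
    Prop :=
  ∀ α β : P, N α β = orderOf (M.longest (α : Set I) * M.longest (β : Set I))

/-- `y` left divides `x`. -/
def LeftDvd {N : Type u} [Monoid N] (y x : N) : Prop := ∃ z, x = y * z

/-- `y` right divides `x`. -/
def RightDvd {N : Type u} [Monoid N] (y x : N) : Prop := ∃ z, x = z * y

/-- `m` is a right lcm of `x` and `y` (a least common multiple for left divisibility). -/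
def IsRightLcm {N : Type u} [Monoid N] (x y m : N) : Prop :=
  (LeftDvd x m ∧ LeftDvd y m) ∧ ∀ z, LeftDvd x z → LeftDvd y z → LeftDvd m z

/-- `m` is a left lcm of `x` and `y` (a least common multiple for right divisibility). -/
def IsLeftLcm {N : Type u} [Monoid N] (x y m : N) : Prop :=
  (RightDvd x m ∧ RightDvd y m) ∧ ∀ z, RightDvd x z → RightDvd y z → RightDvd m z

/-- Morphisms of Artin-Tits monoids that respect right lcm's. -/
structure RespectsRightLcm {A : Type u} {I : Type v} {N : CoxeterMatrix A}
    {M : CoxeterMatrix I} (φ : N.ArtinMonoid →* M.ArtinMonoid) : Prop where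
  map_gen_ne_one : ∀ α, φ (N.artinGen α) ≠ 1
  exists_iff : ∀ α β, (∃ m, IsRightLcm (N.artinGen α) (N.artinGen β) m) ↔
    ∃ m', IsRightLcm (φ (N.artinGen α)) (φ (N.artinGen β)) m'
  eq_map : ∀ α β m m', IsRightLcm (N.artinGen α) (N.artinGen β) m →
    IsRightLcm (φ (N.artinGen α)) (φ (N.artinGen β)) m' → m' = φ m

/-- Morphisms of Artin-Tits monoids that respect left lcm's. -/
structure RespectsLeftLcm {A : Type u} {I : Type v} {N : CoxeterMatrix A}
    {M : CoxeterMatrix I} (φ : N.ArtinMonoid →* M.ArtinMonoid) : Prop where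
  map_gen_ne_one : ∀ α, φ (N.artinGen α) ≠ 1
  exists_iff : ∀ α β, (∃ m, IsLeftLcm (N.artinGen α) (N.artinGen β) m) ↔
    ∃ m', IsLeftLcm (φ (N.artinGen α)) (φ (N.artinGen β)) m'
  eq_map : ∀ α β m m', IsLeftLcm (N.artinGen α) (N.artinGen β) m →
    IsLeftLcm (φ (N.artinGen α)) (φ (N.artinGen β)) m' → m' = φ m

/-- The set of the simple lifts of the `r_α`, `α ∈ P`, in the Artin-Tits monoid. -/
def liftedLongest {I : Type u} (M : CoxeterMatrix I) (P : Set (Set I)) :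
    Set M.ArtinMonoid :=
  (fun α => M.simpleLift (M.longest α)) '' P

end CoxeterMatrix

/-!
Let `x = r_α` and `y = r_β` for two parts of an admissible partition, and let `m` be the order of
`x * y`. As long as the alternating products of length `n` in `x` and `y` starting with `x` and
with `y` differ, admissibility forces lengths to add up in the next alternating products: otherwise
both of the former would have all of `α ∪ β` as left descents, hence be longest elements of
`W_{α ∪ β}` and equal (`IsDihedralPair.len_altProd_of_ne`). So the lift of the alternating product
of length `m` is the alternating product of the lifts, which gives the morphism `φ`. Moreover an
element of `W` with the prefixes `x` and `y` has all elements of `W_{α ∪ β}` as prefixes, whence `m`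
is finite and the alternating product of length `m` is the join of `x` and `y` in the weak order
(`IsDihedralPair.orderOf_ne_zero_and_weakLE`). The same lemmas, applied to two simple reflections,
yield Matsumoto's theorem.

Divisibility in the Artin-Tits monoid of `W` is reduced to the weak order. Bounded joins exist in
the weak order, and they can be computed in two steps along a product with additive lengths
(`isJoin_mul_iff`). This makes the rule "a multiple `v * y` of `v` is divisible by `w` if and only
if `w` and `v` have a join `j` and `y` is divisible by `v⁻¹ * j`" compatible with the braid
relations, so that it defines an action of the monoid (`quotientAction`) which computes all left
quotients by lifts. Left cancellation and the existence of lcm's of lifts with a common multiple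
follow (`simpleLift_mul_left_cancel`, `exists_isJoin_of_leftDvd`).

Finally `φ` reflects left divisibility, by induction on the degree, using cancellation in the target
only (`IsAdmissible.leftDvd_of_leftDvd_artinHom`). Injectivity and the statement on right lcm's
are formal consequences; the statement on left lcm's follows by reversing words, as the `r_α` are
involutions.

The Coxeter-theoretic input which is proved first is the exchange condition, obtained from the
action of `W` on signed elements of `W`, and the fact that the product of two simple reflections
has the order prescribed by the Coxeter matrix, obtained from the geometric representation.
-/

/-! ### The exchange condition -/

namespace CoxeterSystem

open List

variable {B W : Type*} [Group W] {M : CoxeterMatrix B} (cs : CoxeterSystem M W)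

open Classical in
/-- The action of the generator `i` on pairs of a group element and a sign: the element is
conjugated by `s i`, and the sign changes if the element is `s i` itself. -/
noncomputable def signedConj (i : B) : Function.End (W × ZMod 2) :=
  fun p => (cs.simple i * p.1 * cs.simple i, p.2 + if p.1 = cs.simple i then 1 else 0)

open Classical in
/-- A product of the maps `signedConj` along a word counts, modulo two, the occurrences of an
element in the left inversion sequence. The opposite monoid appears since the first letter of
the word acts first. -/
theorem prod_signedConj_apply (ω : List B) (t : W) (ε : ZMod 2) :
    ((ω.map fun i => MulOpposite.op (cs.signedConj i)).prod).unop (t, ε) =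
      ((cs.wordProd ω)⁻¹ * t * cs.wordProd ω, ε + (cs.leftInvSeq ω).count t) := by
  induction ω generalizing t ε with
  | nil =>
    simp only [map_nil, prod_nil, MulOpposite.unop_one, wordProd_nil, leftInvSeq_nil, count_nil]
    change (t, ε) = _
    simp
  | cons i ω ih =>
    have hinj : Function.Injective (MulAut.conj (cs.simple i)) := MulEquiv.injective _
    have ht : t = MulAut.conj (cs.simple i) (cs.simple i * t * cs.simple i) := by
      simp [mul_assoc]
    have hc : (map (MulAut.conj (cs.simple i)) (cs.leftInvSeq ω)).count t =
        (cs.leftInvSeq ω).count (cs.simple i * t * cs.simple i) := by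
      conv_lhs => rw [ht]
      exact count_map_of_injective _ _ hinj _
    rw [map_cons, prod_cons, MulOpposite.unop_mul, MulOpposite.unop_op]
    change (map (fun i => MulOpposite.op (cs.signedConj i)) ω).prod.unop (cs.signedConj i (t, ε)) = _
    rw [signedConj, ih, wordProd_cons, leftInvSeq, count_cons, hc]
    refine Prod.ext (by simp [mul_assoc]) ?_
    by_cases h : t = cs.simple i
    · simp [h, add_comm, add_left_comm]
    · simp [h, Ne.symm h]

theorem prod_map_alternatingWord {N : Type*} [Monoid N] (f : B → N) (i j : B) (n : ℕ) :
    ((alternatingWord i j (2 * n)).map f).prod = (f i * f j) ^ n := by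
  induction n with
  | zero => simp [alternatingWord]
  | succ n ih =>
    rw [show 2 * (n + 1) = 2 * n + 1 + 1 by ring, alternatingWord_succ', alternatingWord_succ',
      if_neg (by simp), if_pos (by simp), map_cons, map_cons, prod_cons, prod_cons, ih, pow_succ',
      mul_assoc]

/-- The second half of the left inversion sequence of the word of a Coxeter relation repeats
the first half. -/
theorem drop_leftInvSeq_alternatingWord (i j : B) :
    (cs.leftInvSeq (alternatingWord i j (2 * M i j))).drop (M i j) =
      (cs.leftInvSeq (alternatingWord i j (2 * M i j))).take (M i j) := by
  apply List.ext_getElem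
  · simp; lia
  · intro k h1 h2
    simp only [length_drop, length_leftInvSeq, length_alternatingWord] at h1
    simp only [getElem_drop, getElem_take]
    rw [getElem_leftInvSeq_alternatingWord _ _ _ _ _ (by lia),
      getElem_leftInvSeq_alternatingWord _ _ _ _ _ (by lia),
      prod_alternatingWord_eq_mul_pow, prod_alternatingWord_eq_mul_pow]
    have h3 : (2 * (M i j + k) + 1) / 2 = M i j + k := by lia
    have h4 : (2 * k + 1) / 2 = k := by lia
    simp [h3, h4, pow_add, parity_simps]

theorem signedConj_isLiftable :
    M.IsLiftable fun i => MulOpposite.op (cs.signedConj i) := by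
  classical
  intro i j
  rw [← prod_map_alternatingWord (fun i => MulOpposite.op (cs.signedConj i)) i j (M i j)]
  apply MulOpposite.unop_injective
  funext ⟨t, ε⟩
  have h1 : cs.wordProd (alternatingWord i j (2 * M i j)) = 1 := by
    rw [wordProd, prod_map_alternatingWord, simple_mul_simple_pow]
  have h2 : ((cs.leftInvSeq (alternatingWord i j (2 * M i j))).count t : ZMod 2) = 0 := by
    rw [← take_append_drop (M i j) (cs.leftInvSeq _), drop_leftInvSeq_alternatingWord,
      count_append, Nat.cast_add, CharTwo.add_self_eq_zero]
  rw [prod_signedConj_apply, h1, h2]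
  simp only [inv_one, one_mul, mul_one, add_zero]
  rfl

open Classical in
/-- The parity of the number of occurrences of `t` in the left inversion sequence of a word
depends only on the product of the word. -/
theorem count_leftInvSeq_eq {ω ω' : List B} (h : cs.wordProd ω = cs.wordProd ω') (t : W) :
    ((cs.leftInvSeq ω).count t : ZMod 2) = (cs.leftInvSeq ω').count t := by
  have key (ω : List B) : cs.lift ⟨_, cs.signedConj_isLiftable⟩ (cs.wordProd ω) =
      (ω.map fun i => MulOpposite.op (cs.signedConj i)).prod := by
    rw [wordProd, map_list_prod, map_map]
    congr 1
    refine map_congr_left fun i _ => ?_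
    simp
  have h2 := cs.prod_signedConj_apply ω t 0
  rw [← key, h, key, prod_signedConj_apply] at h2
  simpa using (congrArg Prod.snd h2).symm

/-- The exchange condition: if `i` is a left descent of the product of a word, then multiplying
by `s i` amounts to deleting a letter of the word, which need not be reduced. -/
theorem exists_eraseIdx_of_isLeftDescent {ω : List B} {i : B}
    (h : cs.IsLeftDescent (cs.wordProd ω) i) :
    ∃ k < ω.length, cs.simple i * cs.wordProd ω = cs.wordProd (ω.eraseIdx k) := by
  classical
  obtain ⟨ω', hω', hw⟩ := cs.exists_isReduced (cs.simple i * cs.wordProd ω)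
  -- `s i` is not a left inversion of `s i * w`, so it does not occur for a reduced word.
  have hnot : cs.simple i ∉ cs.leftInvSeq ω' := by
    intro hmem
    have := (cs.isLeftInversion_of_mem_leftInvSeq hω' hmem).2
    rw [← hw, simple_mul_simple_cancel_left] at this
    exact absurd h (by unfold IsLeftDescent; lia)
  have hcount : ((cs.leftInvSeq ω).count (cs.simple i) : ZMod 2) = 1 := by
    have h1 : cs.wordProd ω = cs.wordProd (i :: ω') := by
      rw [wordProd_cons, ← hw, simple_mul_simple_cancel_left]
    have h2 : cs.simple i ∉ map (MulAut.conj (cs.simple i)) (cs.leftInvSeq ω') := by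
      rw [mem_map]
      rintro ⟨a, ha, hae⟩
      have : a = cs.simple i := by
        rw [MulAut.conj_apply, mul_inv_eq_iff_eq_mul] at hae
        exact mul_left_cancel hae
      exact hnot (this ▸ ha)
    rw [cs.count_leftInvSeq_eq h1, leftInvSeq, count_cons, count_eq_zero_of_not_mem h2]
    simp
  have hmem : cs.simple i ∈ cs.leftInvSeq ω := by
    by_contra hn
    rw [count_eq_zero_of_not_mem hn] at hcount
    simp at hcount
  obtain ⟨k, hk, hke⟩ := getElem_of_mem hmem
  refine ⟨k, by simpa using hk, ?_⟩
  rw [← getD_leftInvSeq_mul_wordProd, getD_eq_getElem _ _ hk, hke]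

end CoxeterSystem

/-! ### The orders of the products of two simple reflections -/

namespace CoxeterMatrix

variable {I : Type*} (M : CoxeterMatrix I)

/-- The simple root with index `i` of the geometric representation. -/
noncomputable def root (i : I) : I →₀ ℝ := Finsupp.single i 1

/-- The simple coroot with index `i` of the geometric representation; it takes the value
`-2 cos (π / M i j)` on the root `j`. If `M i j = 0`, which stands for `∞`, then division by
zero makes this value the right one, `-2`. -/
noncomputable def coroot (i : I) : Module.Dual ℝ (I →₀ ℝ) :=
  Finsupp.linearCombination ℝ fun j => -2 * Real.cos (Real.pi / M i j)

theorem coroot_root (i j : I) : M.coroot i (root j) = -2 * Real.cos (Real.pi / M i j) := by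
  simp [coroot, root]

theorem coroot_root_self (i : I) : M.coroot i (root i) = 2 := by
  simp [coroot_root]

/-- The action of a simple reflection in the geometric representation. -/
noncomputable def geomReflection (i : I) : (I →₀ ℝ) ≃ₗ[ℝ] (I →₀ ℝ) :=
  Module.reflection (M.coroot_root_self i)

theorem coroot_root_mul (i j : I) :
    M.coroot i (root j) * M.coroot j (root i) - 2 = 2 * Real.cos (2 * Real.pi / M i j) := by
  rw [coroot_root, coroot_root, M.symmetric j i, mul_div_assoc 2, Real.cos_two_mul]
  ring

theorem sin_two_pi_div_pos {m : ℕ} (hm : 2 < m) : 0 < Real.sin (2 * Real.pi / m) := by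
  have hpos : (0 : ℝ) < m := by positivity
  refine Real.sin_pos_of_pos_of_lt_pi (by positivity) ?_
  rw [div_lt_iff₀ hpos, mul_comm Real.pi]
  gcongr
  exact_mod_cast hm

theorem two_lt_of_ne {i j : I} (hij : i ≠ j) (h0 : M i j ≠ 0) (h2 : M i j ≠ 2) :
    2 < M i j := by
  have := M.off_diagonal i j hij
  lia

open Polynomial.Chebyshev in
theorem S_eval_eq_div {m : ℕ} (hm : 2 < m) (n : ℤ) :
    (S ℝ n).eval (2 * Real.cos (2 * Real.pi / m)) =
      Real.sin ((n + 1) * (2 * Real.pi / m)) / Real.sin (2 * Real.pi / m) := by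
  rw [eq_div_iff (sin_two_pi_div_pos hm).ne', S_two_mul_real_cos]

open Polynomial.Chebyshev in
theorem geomReflection_isLiftable : M.IsLiftable M.geomReflection := by
  intro i j
  rcases eq_or_ne i j with rfl | hij
  · rw [M.diagonal, pow_one]
    ext1 z
    exact Module.involutive_reflection (M.coroot_root_self i) z
  rcases eq_or_ne (M i j) 0 with h0 | h0
  · rw [h0, pow_zero]
  refine LinearEquiv.ext fun z => ?_
  rw [geomReflection, geomReflection, Module.reflection_mul_reflection_pow_apply _ _ _ _
      (2 * Real.cos (2 * Real.pi / M i j)) (M.coroot_root_mul i j).symm]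
  rcases eq_or_ne (M i j) 2 with h2 | h2
  · simp [M.symmetric j i, h2, coroot_root, S_neg_one]
    module
  have hm := M.two_lt_of_ne hij h0 h2
  have hm0 : (M i j : ℝ) ≠ 0 := by exact_mod_cast h0
  rcases Nat.even_or_odd' (M i j) with ⟨k, hk | hk⟩
  · have e1 : ((M i j : ℤ) - 2) / 2 = k - 1 := by lia
    have e2 : ((M i j : ℤ) - 1) / 2 = k - 1 := by lia
    have hz : (S ℝ (k - 1)).eval (2 * Real.cos (2 * Real.pi / M i j)) = 0 := by
      rw [S_eval_eq_div hm]
      have : (((k - 1 : ℤ) : ℝ) + 1) * (2 * Real.pi / M i j) = Real.pi := by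
        push_cast
        rw [show (M i j : ℝ) = 2 * k by exact_mod_cast hk] at hm0 ⊢
        have hk0 : (k : ℝ) ≠ 0 := right_ne_zero_of_mul hm0
        rw [sub_add_cancel]
        field_simp
      rw [this, Real.sin_pi, zero_div]
    rw [e1, e2, hz]
    simp
  · have e1 : ((M i j : ℤ) - 2) / 2 = k - 1 := by lia
    have e2 : ((M i j : ℤ) - 1) / 2 = k := by lia
    have e3 : ((M i j : ℤ) - 3) / 2 = k - 1 := by lia
    have e4 : (M i j : ℤ) / 2 = k := by lia
    have hz : (S ℝ k).eval (2 * Real.cos (2 * Real.pi / M i j)) +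
        (S ℝ (k - 1)).eval (2 * Real.cos (2 * Real.pi / M i j)) = 0 := by
      rw [S_eval_eq_div hm, S_eval_eq_div hm, ← add_div]
      have : (((k : ℤ) : ℝ) + 1) * (2 * Real.pi / M i j) =
          2 * Real.pi - (((k - 1 : ℤ) : ℝ) + 1) * (2 * Real.pi / M i j) := by
        push_cast
        rw [show (M i j : ℝ) = 2 * k + 1 by exact_mod_cast hk] at hm0 ⊢
        field_simp
        ring
      rw [this, Real.sin_two_pi_sub, neg_add_cancel, zero_div]
    rw [e1, e2, e3, e4, hz]
    simp

open Polynomial.Chebyshev in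
theorem dvd_of_geomReflection_mul_pow_eq_one {i j : I} (hij : i ≠ j) {n : ℕ}
    (h : (M.geomReflection i * M.geomReflection j) ^ n = 1) : M i j ∣ n := by
  have h1 := LinearEquiv.congr_fun h (root i)
  rw [geomReflection, geomReflection, Module.reflection_mul_reflection_pow_apply_self _ _ _
      (2 * Real.cos (2 * Real.pi / M i j)) (M.coroot_root_mul i j).symm] at h1
  have r1 : (root i : I →₀ ℝ) i = 1 := Finsupp.single_eq_same
  have r2 : (root j : I →₀ ℝ) i = 0 := Finsupp.single_eq_of_ne hij
  have r3 : (root i : I →₀ ℝ) j = 0 := Finsupp.single_eq_of_ne hij.symm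
  have r4 : (root j : I →₀ ℝ) j = 1 := Finsupp.single_eq_same
  have hi := DFunLike.congr_fun h1 i
  have hj := DFunLike.congr_fun h1 j
  simp only [Finsupp.add_apply, Finsupp.smul_apply, smul_eq_mul, LinearEquiv.coe_one, id, r1, r2,
    r3, r4, mul_zero, mul_one, zero_add, add_zero] at hi hj
  have hc : M.coroot j (root i) = -2 * Real.cos (Real.pi / M i j) := by
    rw [coroot_root, M.symmetric i j]
  rw [hc] at hj
  rcases eq_or_ne (M i j) 0 with h0 | h0
  · rw [h0] at hj ⊢
    simp at hj
    simpa using hj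
  rcases eq_or_ne (M i j) 2 with h2 | h2
  · rw [h2] at hi ⊢
    have e : 2 * Real.cos (2 * Real.pi / (2 : ℕ)) = -2 := by simp
    rw [e, S_eval_neg_two, S_eval_neg_two] at hi
    rcases Nat.even_or_odd n with he | ho
    · exact he.two_dvd
    · exfalso
      have ho' : Odd (n : ℤ) := by exact_mod_cast ho
      rw [Int.negOnePow_odd _ ho', Int.negOnePow_even _ (ho'.sub_odd odd_one)] at hi
      push_cast at hi
      linarith
  have hm := M.two_lt_of_ne hij h0 h2
  have hm0 : (M i j : ℝ) ≠ 0 := by exact_mod_cast h0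
  have hsin := sin_two_pi_div_pos hm
  have hcos : 0 < Real.cos (Real.pi / M i j) := by
    apply Real.cos_pos_of_mem_Ioo
    have hp : 0 < Real.pi / M i j := by positivity
    refine ⟨by linarith [Real.pi_pos], ?_⟩
    gcongr
    exact_mod_cast hm
  have hS : (S ℝ (n - 1)).eval (2 * Real.cos (2 * Real.pi / M i j)) = 0 := by
    rcases mul_eq_zero.mp hj with h | h
    · exact h
    · linarith
  rw [hS, add_zero, S_eval_eq_div hm, div_eq_one_iff_eq hsin.ne', add_mul, one_mul,
    Real.sin_add] at hi
  rw [S_eval_eq_div hm, div_eq_zero_iff, or_iff_left hsin.ne'] at hS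
  push_cast at hS hi
  rw [sub_add_cancel] at hS
  rw [hS, zero_mul, zero_add] at hi
  -- The angle `n * (2 * π / M i j)` has sine `0` and cosine `1`.
  obtain ⟨k, hk⟩ := (Real.cos_eq_one_iff _).mp
    (mul_right_cancel₀ hsin.ne' (hi.trans (one_mul _).symm))
  have hpi := Real.pi_ne_zero
  field_simp at hk
  have hk' : k * (M i j : ℤ) = n := by exact_mod_cast hk
  exact Int.natCast_dvd_natCast.mp ⟨k, by rw [← hk', mul_comm]⟩

theorem orderOf_geomReflection_mul (i j : I) :
    orderOf (M.geomReflection i * M.geomReflection j) = M i j := by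
  apply Nat.dvd_antisymm
  · exact orderOf_dvd_of_pow_eq_one (M.geomReflection_isLiftable i j)
  · rcases eq_or_ne i j with rfl | hij
    · rw [M.diagonal]
      exact one_dvd _
    · exact M.dvd_of_geomReflection_mul_pow_eq_one hij (pow_orderOf_eq_one _)

end CoxeterMatrix

/-- The product of two simple reflections has the order prescribed by the Coxeter matrix. -/
theorem CoxeterSystem.orderOf_simple_mul_simple {B W : Type*} [Group W] {M : CoxeterMatrix B}
    (cs : CoxeterSystem M W) (i j : B) :
    orderOf (cs.simple i * cs.simple j) = M i j := by
  apply Nat.dvd_antisymm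
  · exact orderOf_dvd_of_pow_eq_one (cs.simple_mul_simple_pow i j)
  · have h := orderOf_map_dvd (cs.lift ⟨_, M.geomReflection_isLiftable⟩)
      (cs.simple i * cs.simple j)
    rwa [map_mul, cs.lift_apply_simple, cs.lift_apply_simple,
      M.orderOf_geomReflection_mul] at h

/-! ### The left weak order and the parabolic subgroups -/

namespace CoxeterMatrix

variable {I : Type*} (M : CoxeterMatrix I)

theorem len_one : M.len 1 = 0 := M.toCoxeterSystem.length_one

theorem len_inv (w : M.Group) : M.len w⁻¹ = M.len w := M.toCoxeterSystem.length_inv w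

theorem len_eq_zero_iff {w : M.Group} : M.len w = 0 ↔ w = 1 :=
  M.toCoxeterSystem.length_eq_zero_iff

theorem len_mul_le (v w : M.Group) : M.len (v * w) ≤ M.len v + M.len w :=
  M.toCoxeterSystem.length_mul_le v w

theorem len_simple (i : I) : M.len (M.simple i) = 1 := M.toCoxeterSystem.length_simple i

theorem simple_mul_simple_self (i : I) : M.simple i * M.simple i = 1 :=
  M.toCoxeterSystem.simple_mul_simple_self i

theorem simple_mul_simple_mul (i : I) (w : M.Group) : M.simple i * (M.simple i * w) = w := by
  rw [← mul_assoc, simple_mul_simple_self, one_mul]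

theorem inv_simple (i : I) : (M.simple i)⁻¹ = M.simple i := M.toCoxeterSystem.inv_simple i

theorem len_simple_mul (w : M.Group) (i : I) :
    M.len (M.simple i * w) = M.len w + 1 ∨ M.len (M.simple i * w) + 1 = M.len w :=
  M.toCoxeterSystem.length_simple_mul w i

theorem len_wordProd_le (ω : List I) : M.len (M.toCoxeterSystem.wordProd ω) ≤ ω.length :=
  M.toCoxeterSystem.length_wordProd_le ω

theorem wordProd_cons (i : I) (ω : List I) :
    M.toCoxeterSystem.wordProd (i :: ω) = M.simple i * M.toCoxeterSystem.wordProd ω :=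
  M.toCoxeterSystem.wordProd_cons i ω

theorem exists_reduced_word (w : M.Group) :
    ∃ ω : List I, M.toCoxeterSystem.wordProd ω = w ∧ ω.length = M.len w := by
  obtain ⟨ω, hω, rfl⟩ := M.toCoxeterSystem.exists_isReduced w
  exact ⟨ω, rfl, hω.symm⟩

theorem simple_injective : Function.Injective M.simple := by
  intro i j h
  by_contra hij
  apply M.off_diagonal i j hij
  have := M.toCoxeterSystem.orderOf_simple_mul_simple i j
  rw [M.toCoxeterSystem_simple, h, simple_mul_simple_self, orderOf_one] at this
  exact this.symm

/-- The left descents of `w`: the indices `i` such that `s i * w` is shorter than `w`. -/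
def leftDescents (w : M.Group) : Set I := {i | M.len (M.simple i * w) < M.len w}

variable {M}

theorem mem_leftDescents {w : M.Group} {i : I} :
    i ∈ M.leftDescents w ↔ M.len (M.simple i * w) + 1 = M.len w := by
  have := M.len_simple_mul w i
  simp only [leftDescents, Set.mem_ofPred_eq]
  lia

theorem notMem_leftDescents {w : M.Group} {i : I} :
    i ∉ M.leftDescents w ↔ M.len (M.simple i * w) = M.len w + 1 := by
  have := M.len_simple_mul w i
  simp only [leftDescents, Set.mem_ofPred_eq]
  lia

theorem mem_ascents_iff {w : M.Group} {i : I} : i ∈ M.ascents w ↔ i ∉ M.leftDescents w⁻¹ := by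
  rw [notMem_leftDescents, len_inv, ← len_inv, mul_inv_rev, inv_inv, inv_simple]
  rfl

theorem mem_descents_iff {w : M.Group} {i : I} : i ∈ M.descents w ↔ i ∈ M.leftDescents w⁻¹ := by
  rw [mem_leftDescents, len_inv, ← M.len_inv (M.simple i * _), mul_inv_rev, inv_inv, inv_simple]
  rfl

/-- The exchange condition for a product `u * v` whose first factor does not have the left
descent `i`: the deletion takes place in the second factor. -/
theorem exists_mul_eq_of_mem_leftDescents_mul {u v : M.Group} {i : I}
    (hu : i ∉ M.leftDescents u) (huv : i ∈ M.leftDescents (u * v)) :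
    ∃ v', M.len v' < M.len v ∧ M.simple i * (u * v) = u * v' := by
  obtain ⟨a, rfl, ha⟩ := M.exists_reduced_word u
  obtain ⟨b, rfl, hb⟩ := M.exists_reduced_word v
  rw [← CoxeterSystem.wordProd_append] at huv ⊢
  obtain ⟨k, hk, h⟩ := M.toCoxeterSystem.exists_eraseIdx_of_isLeftDescent huv
  rw [M.toCoxeterSystem_simple] at h
  rcases lt_or_ge k a.length with hka | hka
  · exfalso
    rw [List.eraseIdx_append_of_lt_length hka, CoxeterSystem.wordProd_append,
      CoxeterSystem.wordProd_append, ← mul_assoc] at h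
    have h1 := mul_right_cancel h
    apply hu
    have h2 := M.len_wordProd_le (a.eraseIdx k)
    rw [← h1, List.length_eraseIdx_of_lt hka] at h2
    simp only [leftDescents, Set.mem_ofPred_eq]
    lia
  · rw [List.eraseIdx_append_of_length_le hka,
      CoxeterSystem.wordProd_append _ a (b.eraseIdx _)] at h
    refine ⟨_, ?_, h⟩
    have h2 := M.len_wordProd_le (b.eraseIdx (k - a.length))
    rw [List.length_append] at hk
    rw [List.length_eraseIdx_of_lt (by lia)] at h2
    lia

/-- The weak order on the Coxeter group: `u` is a prefix of `w`, in the sense that some reduced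
word of `w` starts with a reduced word of `u`. -/
def WeakLE (u w : M.Group) : Prop := M.len u + M.len (u⁻¹ * w) = M.len w

theorem weakLE_mul_iff {u v : M.Group} :
    WeakLE u (u * v) ↔ M.len (u * v) = M.len u + M.len v := by
  rw [WeakLE, inv_mul_cancel_left, eq_comm]

theorem WeakLE.refl (w : M.Group) : WeakLE w w := by simp [WeakLE, len_one]

theorem one_weakLE (w : M.Group) : WeakLE 1 w := by simp [WeakLE, len_one]

theorem WeakLE.len_le {u w : M.Group} (h : WeakLE u w) : M.len u ≤ M.len w := by
  unfold WeakLE at h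
  lia

theorem WeakLE.trans {u v w : M.Group} (h1 : WeakLE u v) (h2 : WeakLE v w) : WeakLE u w := by
  unfold WeakLE at *
  have h3 := M.len_mul_le (u⁻¹ * v) (v⁻¹ * w)
  have h4 := M.len_mul_le u (u⁻¹ * w)
  rw [mul_assoc, mul_inv_cancel_left] at h3
  rw [mul_inv_cancel_left] at h4
  lia

theorem WeakLE.eq_of_len_le {u w : M.Group} (h : WeakLE u w) (hl : M.len w ≤ M.len u) :
    u = w := by
  have h1 : M.len (u⁻¹ * w) = 0 := by
    unfold WeakLE at h
    lia
  rwa [len_eq_zero_iff, inv_mul_eq_one] at h1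

theorem WeakLE.antisymm {u v : M.Group} (h1 : WeakLE u v) (h2 : WeakLE v u) : u = v :=
  h1.eq_of_len_le h2.len_le

theorem WeakLE.inv_mul_iff {v a b : M.Group} (ha : WeakLE v a) (hb : WeakLE v b) :
    WeakLE (v⁻¹ * a) (v⁻¹ * b) ↔ WeakLE a b := by
  unfold WeakLE at *
  rw [show (v⁻¹ * a)⁻¹ * (v⁻¹ * b) = a⁻¹ * b by group]
  lia

theorem simple_weakLE_iff {w : M.Group} {i : I} :
    WeakLE (M.simple i) w ↔ i ∈ M.leftDescents w := by
  rw [mem_leftDescents, WeakLE, len_simple, inv_simple, add_comm]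

theorem WeakLE.mul_iff {x a u : M.Group} (hxa : WeakLE x a)
    (hxu : M.len (x * u) = M.len x + M.len u) : WeakLE (x * u) a ↔ WeakLE u (x⁻¹ * a) := by
  rw [← (weakLE_mul_iff.mpr hxu).inv_mul_iff hxa, inv_mul_cancel_left]

/-- The lifting property of the weak order. -/
theorem WeakLE.simple_mul {u w : M.Group} {i : I} (h : WeakLE u w) (hu : i ∉ M.leftDescents u)
    (hw : i ∈ M.leftDescents w) : WeakLE (M.simple i * u) w := by
  obtain ⟨v', hv', he⟩ :=
    exists_mul_eq_of_mem_leftDescents_mul (v := u⁻¹ * w) hu (by simpa using hw)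
  rw [mul_inv_cancel_left] at he
  have h1 : (M.simple i * u)⁻¹ * w = v' := by
    rw [mul_inv_rev, inv_simple, mul_assoc, he, inv_mul_cancel_left]
  have h2 := M.len_mul_le (M.simple i * u) v'
  rw [← h1, mul_inv_cancel_left, h1] at h2
  rw [notMem_leftDescents] at hu
  unfold WeakLE at *
  rw [h1]
  lia

theorem simple_mem_parabolic {J : Set I} {i : I} (hi : i ∈ J) : M.simple i ∈ M.parabolic J :=
  Subgroup.subset_closure (Set.mem_image_of_mem _ hi)

theorem parabolic_mono {J K : Set I} (h : J ⊆ K) : M.parabolic J ≤ M.parabolic K :=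
  Subgroup.closure_mono (Set.image_mono h)

theorem wordProd_mem_parabolic {J : Set I} {ω : List I} (h : ∀ i ∈ ω, i ∈ J) :
    M.toCoxeterSystem.wordProd ω ∈ M.parabolic J := by
  apply Subgroup.list_prod_mem
  intro x hx
  obtain ⟨i, hi, rfl⟩ := List.mem_map.mp hx
  exact simple_mem_parabolic (h i hi)

theorem simple_mul_mem_parabolic_iff {J : Set I} {i : I} {u : M.Group} (hi : i ∈ J) :
    M.simple i * u ∈ M.parabolic J ↔ u ∈ M.parabolic J :=
  (M.parabolic J).mul_mem_cancel_left (simple_mem_parabolic hi)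

/-- An element of a parabolic subgroup has a reduced word with letters in the given subset. -/
theorem exists_reduced_word_of_mem_parabolic {J : Set I} {u : M.Group} (hu : u ∈ M.parabolic J) :
    ∃ ω : List I, (∀ i ∈ ω, i ∈ J) ∧ M.toCoxeterSystem.wordProd ω = u ∧ ω.length = M.len u := by
  have step (i : I) (hi : i ∈ J) (w : M.Group) (h : ∃ ω : List I, (∀ i ∈ ω, i ∈ J) ∧
      M.toCoxeterSystem.wordProd ω = w ∧ ω.length = M.len w) : ∃ ω : List I, (∀ i ∈ ω, i ∈ J) ∧
      M.toCoxeterSystem.wordProd ω = M.simple i * w ∧ ω.length = M.len (M.simple i * w) := by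
    obtain ⟨ω, hω, rfl, hl⟩ := h
    by_cases hd : i ∈ M.leftDescents (M.toCoxeterSystem.wordProd ω)
    · obtain ⟨k, hk, h⟩ := M.toCoxeterSystem.exists_eraseIdx_of_isLeftDescent hd
      refine ⟨ω.eraseIdx k, fun j hj => hω j (List.mem_of_mem_eraseIdx hj), h.symm, ?_⟩
      rw [mem_leftDescents] at hd
      rw [List.length_eraseIdx_of_lt hk]
      lia
    · refine ⟨i :: ω, by simpa using ⟨hi, hω⟩, M.wordProd_cons i ω, ?_⟩
      rw [notMem_leftDescents] at hd
      rw [List.length_cons, hl, hd]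
  induction hu using Subgroup.closure_induction_left with
  | one => exact ⟨[], by simp, by simp, by simp [len_one]⟩
  | mul_left x hx y _ ih =>
    obtain ⟨i, hi, rfl⟩ := hx
    exact step i hi y ih
  | inv_mul_cancel x hx y _ ih =>
    obtain ⟨i, hi, rfl⟩ := hx
    rw [inv_simple]
    exact step i hi y ih

theorem exists_mem_leftDescents_of_mem_parabolic {J : Set I} {u : M.Group}
    (hu : u ∈ M.parabolic J) (h1 : u ≠ 1) : ∃ i ∈ J, i ∈ M.leftDescents u := by
  obtain ⟨ω, hω, rfl, hl⟩ := exists_reduced_word_of_mem_parabolic hu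
  cases ω with
  | nil => simp at h1
  | cons i ω =>
    refine ⟨i, hω i (by simp), ?_⟩
    have := M.len_wordProd_le ω
    simp only [leftDescents, Set.mem_ofPred_eq]
    rw [← hl, M.wordProd_cons, simple_mul_simple_mul, List.length_cons]
    lia

/-- Induction on the elements of a parabolic subgroup along reduced words. -/
theorem parabolic_induction {J : Set I} {p : M.Group → Prop} (one : p 1)
    (step : ∀ i ∈ J, ∀ u ∈ M.parabolic J, i ∉ M.leftDescents u → p u → p (M.simple i * u))
    {u : M.Group} (hu : u ∈ M.parabolic J) : p u := by
  induction hn : M.len u generalizing u with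
  | zero => rwa [M.len_eq_zero_iff.mp hn]
  | succ n ih =>
    obtain ⟨i, hi, hd⟩ := exists_mem_leftDescents_of_mem_parabolic hu
      (by rintro rfl; simp [len_one] at hn)
    rw [← M.simple_mul_simple_mul i u]
    have hu' := (simple_mul_mem_parabolic_iff hi).mpr hu
    rw [mem_leftDescents] at hd
    refine step i hi _ hu' ?_ (ih hu' (by lia))
    rw [notMem_leftDescents, simple_mul_simple_mul]
    lia

/-- An element with all left descents in `J` has all elements of `W_J` as prefixes. -/
theorem weakLE_of_subset_leftDescents {J : Set I} {u w : M.Group} (hw : J ⊆ M.leftDescents w)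
    (hu : u ∈ M.parabolic J) : WeakLE u w :=
  parabolic_induction (p := fun u => WeakLE u w) (one_weakLE w)
    (fun _ hi _ _ hd h => h.simple_mul hd (hw hi)) hu

/-- An element without left descents in `J` is the shortest element of its coset of `W_J`, and
lengths add up in this coset. -/
theorem len_mul_of_disjoint_leftDescents {J : Set I} {u w : M.Group}
    (hw : ∀ i ∈ J, i ∉ M.leftDescents w) (hu : u ∈ M.parabolic J) :
    M.len (u * w) = M.len u + M.len w := by
  obtain ⟨v, hv, hmin⟩ := WellFounded.has_min (InvImage.wf (fun v => M.len (v * w)) wellFounded_lt)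
    (M.parabolic J : Set M.Group) ⟨1, (M.parabolic J).one_mem⟩
  have key {x : M.Group} (hx : x ∈ M.parabolic J) :
      M.len (x * (v * w)) = M.len x + M.len (v * w) := by
    refine parabolic_induction (p := fun x => M.len (x * (v * w)) = M.len x + M.len (v * w))
      (by simp [len_one]) (fun i hi x hx hd hlen => ?_) hx
    by_cases h : i ∈ M.leftDescents (x * (v * w))
    · obtain ⟨y, hy, he⟩ := exists_mul_eq_of_mem_leftDescents_mul hd h
      have hy' : y = (x⁻¹ * M.simple i * x * v) * w := by
        rw [← inv_mul_eq_iff_eq_mul] at he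
        rw [← he]
        group
      rw [hy'] at hy
      exact absurd hy (hmin _ (mul_mem (mul_mem (mul_mem (inv_mem hx)
        (simple_mem_parabolic hi)) hx) hv))
    · rw [notMem_leftDescents] at h hd
      rw [mul_assoc, h, hd, hlen]
      lia
  have hv1 : v = 1 := by
    by_contra hne
    obtain ⟨i, hi, hd⟩ := exists_mem_leftDescents_of_mem_parabolic (inv_mem hv)
      (inv_ne_one.mpr hne)
    apply hw i hi
    have h1 := key (inv_mem hv)
    have h2 := key ((simple_mul_mem_parabolic_iff hi).mpr (inv_mem hv))
    rw [mul_assoc, inv_mul_cancel_left] at h2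
    rw [inv_mul_cancel_left] at h1
    rw [mem_leftDescents] at hd ⊢
    lia
  simpa [hv1] using key hu

theorem len_mul_of_subset_ascents {J : Set I} {u w : M.Group}
    (hw : J ⊆ M.ascents w) (hu : u ∈ M.parabolic J) :
    M.len (w * u) = M.len w + M.len u := by
  have := len_mul_of_disjoint_leftDescents (w := w⁻¹) (fun i hi => mem_ascents_iff.mp (hw hi))
    (inv_mem hu)
  rw [← mul_inv_rev, len_inv, len_inv, len_inv] at this
  lia

end CoxeterMatrix

/-! ### Bounded joins in the weak order -/

namespace CoxeterMatrix

variable {I : Type*} {M : CoxeterMatrix I}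

theorem WeakLE.mul_simple {b x : M.Group} {i : I} (h : WeakLE b x)
    (hi : i ∈ M.leftDescents (b⁻¹ * x)) :
    i ∈ M.ascents b ∧ WeakLE (b * M.simple i) x := by
  have hasc : i ∈ M.ascents b := by
    have h1 := mem_leftDescents.mp hi
    have h2 := M.len_mul_le (b * M.simple i) (M.simple i * (b⁻¹ * x))
    rw [mul_assoc, simple_mul_simple_mul, mul_inv_cancel_left] at h2
    have h3 := M.len_mul_le b (M.simple i)
    rw [len_simple] at h3
    simp only [ascents, Set.mem_ofPred_eq]
    unfold WeakLE at h
    lia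
  refine ⟨hasc, ?_⟩
  rw [h.mul_iff (by rw [len_simple]; exact hasc), simple_weakLE_iff]
  exact hi

/-- A set of elements of the Coxeter group that is closed under prefixes, has bounded lengths,
and contains `x * u` for all `u` in the dihedral subgroup of `s` and `t` as soon as it contains
`x * s` and `x * t`, with additive lengths, has a largest element in the weak order. -/
theorem exists_weakLE_max {E : Set M.Group} (h1 : (1 : M.Group) ∈ E)
    (hpre : ∀ x ∈ E, ∀ y, WeakLE y x → y ∈ E) {n : ℕ} (hn : ∀ x ∈ E, M.len x ≤ n)
    (hloc : ∀ x, ∀ i ∈ M.ascents x, ∀ j ∈ M.ascents x, x * M.simple i ∈ E →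
      x * M.simple j ∈ E → ∀ u ∈ M.parabolic {i, j}, x * u ∈ E) :
    ∃ m ∈ E, ∀ x ∈ E, WeakLE x m := by
  -- A nonempty subset of `E` has an element of maximal length.
  have hmax (A : Set M.Group) (hA : A ⊆ E) (hne : A.Nonempty) :
      ∃ m ∈ A, ∀ x ∈ A, M.len x ≤ M.len m := by
    obtain ⟨m, hm, h⟩ := WellFounded.has_min (InvImage.wf (fun v => n - M.len v) wellFounded_lt)
      A hne
    refine ⟨m, hm, fun x hx => ?_⟩
    have h2 := h x hx
    have h3 := hn x (hA hx)
    have h4 := hn m (hA hm)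
    simp only [InvImage] at h2
    lia
  obtain ⟨m, hm, hmm⟩ := hmax E le_rfl ⟨1, h1⟩
  refine ⟨m, hm, ?_⟩
  by_contra! hcon
  obtain ⟨x, hx, hxm⟩ := hcon
  -- `A` consists of the prefixes of `m` that can be extended inside `E` by one letter to a
  -- non-prefix of `m`. An element of maximal length in `A` leads to a contradiction.
  let A : Set M.Group := {z | WeakLE z m ∧ ∃ i ∈ M.ascents z, z * M.simple i ∈ E ∧
    ¬ WeakLE (z * M.simple i) m}
  have hA : A.Nonempty := by
    obtain ⟨b, hb, hbm⟩ := hmax {z | WeakLE z m ∧ WeakLE z x} (fun z hz => hpre x hx z hz.2)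
      ⟨1, one_weakLE m, one_weakLE x⟩
    have hne : b⁻¹ * x ≠ 1 := by
      intro h
      rw [inv_mul_eq_one] at h
      exact hxm (h ▸ hb.1)
    obtain ⟨i, hi⟩ := M.toCoxeterSystem.exists_leftDescent_of_ne_one hne
    replace hi : i ∈ M.leftDescents (b⁻¹ * x) := hi
    obtain ⟨hasc, hbi⟩ := hb.2.mul_simple hi
    refine ⟨b, hb.1, i, hasc, hpre x hx _ hbi, fun h => ?_⟩
    have h2 := hbm _ ⟨h, hbi⟩
    simp only [ascents, Set.mem_ofPred_eq] at hasc
    lia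
  obtain ⟨z, ⟨hzm, i, hi, hiE, him⟩, hzmax⟩ := hmax A (fun z hz => hpre m hm z hz.1) hA
  have hzne : z⁻¹ * m ≠ 1 := by
    intro h
    rw [inv_mul_eq_one] at h
    have h2 := hmm _ hiE
    simp only [ascents, Set.mem_ofPred_eq, h] at hi h2
    lia
  obtain ⟨j, hj⟩ := M.toCoxeterSystem.exists_leftDescent_of_ne_one hzne
  replace hj : j ∈ M.leftDescents (z⁻¹ * m) := hj
  obtain ⟨hja, hjm⟩ := hzm.mul_simple hj
  have hE := hloc z i hi j hja hiE (hpre m hm _ hjm)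
  have hadd {u : M.Group} (hu : u ∈ M.parabolic {i, j}) : M.len (z * u) = M.len z + M.len u :=
    len_mul_of_subset_ascents (by rintro k (rfl | rfl) <;> assumption) hu
  -- By the maximality of `z`, one can climb from `z * s j` inside the dihedral coset of `z`,
  -- staying below `m`, up to the top of the coset.
  obtain ⟨_, ⟨u, rfl, hu, hum, hpos⟩, humax⟩ := hmax
    {y | ∃ u, y = z * u ∧ u ∈ M.parabolic {i, j} ∧ WeakLE (z * u) m ∧ 0 < M.len u}
    (by rintro _ ⟨u, rfl, hu, -⟩; exact hE u hu)
    ⟨_, M.simple j, rfl, simple_mem_parabolic (by simp), hjm, by simp [len_simple]⟩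
  have hdesc : ({i, j} : Set I) ⊆ M.leftDescents u⁻¹ := by
    intro k hk
    by_contra hcon
    rw [notMem_leftDescents, len_inv, ← M.len_inv (M.simple k * _), mul_inv_rev, inv_inv,
      inv_simple] at hcon
    have hk' : u * M.simple k ∈ M.parabolic {i, j} := mul_mem hu (simple_mem_parabolic hk)
    have hle : WeakLE (z * (u * M.simple k)) m := by
      by_contra hnot
      have h2 := hzmax (z * u) ⟨hum, k, by
        simp only [ascents, Set.mem_ofPred_eq]
        rw [mul_assoc, hadd hk', hadd hu]
        lia, by rw [mul_assoc]; exact hE _ hk', by rwa [mul_assoc]⟩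
      rw [hadd hu] at h2
      lia
    have h2 := humax _ ⟨_, rfl, hk', hle, by lia⟩
    rw [hadd hk', hadd hu] at h2
    lia
  -- The top of the dihedral coset lies above `z * s i`.
  have hiu : i ∈ M.leftDescents u := by
    have hsi : M.simple i * u ∈ M.parabolic {i, j} :=
      (simple_mul_mem_parabolic_iff (by simp)).mpr hu
    have h2 := (weakLE_of_subset_leftDescents hdesc (inv_mem hsi)).len_le
    rw [len_inv, len_inv] at h2
    rw [mem_leftDescents]
    rcases M.len_simple_mul u i with h | h <;> lia
  apply him
  refine WeakLE.trans ?_ hum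
  have hzu : WeakLE z (z * u) := weakLE_mul_iff.mpr (hadd hu)
  rw [hzu.mul_iff (by rw [len_simple]; exact hi), inv_mul_cancel_left, simple_weakLE_iff]
  exact hiu

/-- The set of prefixes of `a` satisfies the local condition of `exists_weakLE_max`. -/
theorem weakLE_mul_of_parabolic {x a u : M.Group} {i j : I} (hi : i ∈ M.ascents x)
    (hj : j ∈ M.ascents x) (hia : WeakLE (x * M.simple i) a) (hja : WeakLE (x * M.simple j) a)
    (hu : u ∈ M.parabolic {i, j}) : WeakLE (x * u) a := by
  have hi' : M.len (x * M.simple i) = M.len x + M.len (M.simple i) := by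
    rw [len_simple]
    exact hi
  have hj' : M.len (x * M.simple j) = M.len x + M.len (M.simple j) := by
    rw [len_simple]
    exact hj
  have hxa : WeakLE x a := (weakLE_mul_iff.mpr hi').trans hia
  rw [hxa.mul_iff hi', simple_weakLE_iff] at hia
  rw [hxa.mul_iff hj', simple_weakLE_iff] at hja
  rw [hxa.mul_iff (len_mul_of_subset_ascents (by rintro k (rfl | rfl) <;> assumption) hu)]
  exact weakLE_of_subset_leftDescents (by rintro k (rfl | rfl) <;> assumption) hu

/-- `j` is the join of `u` and `v` in the weak order. -/
def IsJoin (u v j : M.Group) : Prop :=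
  WeakLE u j ∧ WeakLE v j ∧ ∀ z, WeakLE u z → WeakLE v z → WeakLE j z

theorem IsJoin.unique {u v j k : M.Group} (hj : IsJoin u v j) (hk : IsJoin u v k) : j = k :=
  (hj.2.2 k hk.1 hk.2.1).antisymm (hk.2.2 j hj.1 hj.2.1)

/-- Two elements with an upper bound in the weak order have a join. -/
theorem exists_isJoin {u v b : M.Group} (hu : WeakLE u b) (hv : WeakLE v b) :
    ∃ j, IsJoin u v j := by
  -- The join is the meet of all upper bounds.
  obtain ⟨m, hm, h⟩ := exists_weakLE_max
    (E := {x : M.Group | ∀ a, WeakLE u a → WeakLE v a → WeakLE x a}) (n := M.len b)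
    (fun a _ _ => one_weakLE a) (fun x hx y hy a hua hva => hy.trans (hx a hua hva))
    (fun x hx => (hx b hu hv).len_le)
    (fun x i hi j hj hiE hjE w hw a hua hva =>
      weakLE_mul_of_parabolic hi hj (hiE a hua hva) (hjE a hua hva) hw)
  exact ⟨m, h u fun a hua _ => hua, h v fun a _ hva => hva, hm⟩

/-- If lengths add up in `v * y` and in `v * y'`, then they add up in `v * z` for the join `z`
of `y` and `y'`. -/
theorem IsJoin.len_mul {v y y' z : M.Group} (hz : IsJoin y y' z)
    (hy : M.len (v * y) = M.len v + M.len y) (hy' : M.len (v * y') = M.len v + M.len y') :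
    M.len (v * z) = M.len v + M.len z := by
  have key : ∃ m ∈ {x : M.Group | M.len (v * x) = M.len v + M.len x ∧ WeakLE x z},
      ∀ x ∈ {x : M.Group | M.len (v * x) = M.len v + M.len x ∧ WeakLE x z}, WeakLE x m := by
    refine exists_weakLE_max (n := M.len z)
      ⟨by simp [len_one], one_weakLE z⟩ ?_ (fun x hx => hx.2.len_le) ?_
    · rintro x ⟨hx, hxz⟩ a ha
      refine ⟨?_, ha.trans hxz⟩
      have h1 := M.len_mul_le (v * a) (a⁻¹ * x)
      rw [mul_assoc, mul_inv_cancel_left] at h1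
      have h2 := M.len_mul_le v a
      unfold WeakLE at ha
      lia
    · rintro x i hi j hj ⟨hi1, hi2⟩ ⟨hj1, hj2⟩ u hu
      refine ⟨?_, weakLE_mul_of_parabolic hi hj hi2 hj2 hu⟩
      have hvx : M.len (v * x) = M.len v + M.len x := by
        have h1 := M.len_mul_le (v * x) (M.simple i)
        have h2 := M.len_mul_le v x
        simp only [ascents, Set.mem_ofPred_eq] at hi
        rw [len_simple, mul_assoc] at h1
        lia
      have hasc : ({i, j} : Set I) ⊆ M.ascents (v * x) := by
        simp only [ascents, Set.mem_ofPred_eq] at hi hj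
        rintro k (rfl | rfl) <;> simp only [ascents, Set.mem_ofPred_eq] <;> rw [mul_assoc] <;> lia
      rw [← mul_assoc, len_mul_of_subset_ascents hasc hu, hvx, len_mul_of_subset_ascents (by
        rintro k (rfl | rfl) <;> assumption) hu, add_assoc]
  obtain ⟨m, ⟨hm, hmz⟩, h⟩ := key
  rwa [hmz.antisymm (hz.2.2 m (h y ⟨hy, hz.1⟩) (h y' ⟨hy', hz.2.1⟩))] at hm

/-- Joins can be computed in two steps. -/
theorem isJoin_mul_iff {w v v' J : M.Group} (h : M.len (v * v') = M.len v + M.len v') :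
    IsJoin w (v * v') J ↔ ∃ j, IsJoin w v j ∧ IsJoin (v⁻¹ * j) v' (v⁻¹ * J) := by
  have hvv := weakLE_mul_iff.mpr h
  have back {j k : M.Group} (hj : IsJoin w v j) (hk : IsJoin (v⁻¹ * j) v' k) :
      IsJoin w (v * v') (v * k) := by
    have hvk : WeakLE v (v * k) := by
      refine weakLE_mul_iff.mpr (hk.len_mul ?_ h)
      rw [mul_inv_cancel_left]
      exact hj.2.1.symm
    refine ⟨hj.1.trans ?_, ?_, fun z hwz hvz => ?_⟩
    · rw [← hj.2.1.inv_mul_iff hvk, inv_mul_cancel_left]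
      exact hk.1
    · rw [← hvv.inv_mul_iff hvk, inv_mul_cancel_left, inv_mul_cancel_left]
      exact hk.2.1
    · have hvz' := hvv.trans hvz
      have hjz := hj.2.2 z hwz hvz'
      rw [← hvk.inv_mul_iff hvz', inv_mul_cancel_left]
      refine hk.2.2 _ ((hj.2.1.inv_mul_iff hvz').mpr hjz) ?_
      rw [← hvv.inv_mul_iff hvz', inv_mul_cancel_left] at hvz
      exact hvz
  constructor
  · intro hJ
    have hvJ := hvv.trans hJ.2.1
    obtain ⟨j, hj⟩ := exists_isJoin hJ.1 hvJ
    have h1 : WeakLE (v⁻¹ * j) (v⁻¹ * J) :=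
      (hj.2.1.inv_mul_iff hvJ).mpr (hj.2.2 J hJ.1 hvJ)
    have h2 : WeakLE v' (v⁻¹ * J) := by
      have := hJ.2.1
      rwa [← hvv.inv_mul_iff hvJ, inv_mul_cancel_left] at this
    obtain ⟨k, hk⟩ := exists_isJoin h1 h2
    refine ⟨j, hj, ?_⟩
    rw [hJ.unique (back hj hk), inv_mul_cancel_left]
    exact hk
  · rintro ⟨j, hj, hk⟩
    have := back hj hk
    rwa [mul_inv_cancel_left] at this

end CoxeterMatrix

/-! ### Longest elements -/

namespace CoxeterMatrix

variable {I : Type*} {M : CoxeterMatrix I}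

theorem IsLongestIn.subset_leftDescents {J : Set I} {r : M.Group} (h : M.IsLongestIn J r) :
    J ⊆ M.leftDescents r := by
  intro i hi
  by_contra hd
  have := h.2 _ ((simple_mul_mem_parabolic_iff hi).mpr h.1)
  rw [notMem_leftDescents] at hd
  lia

/-- A longest element is unique since each of two longest elements is a prefix of the other. -/
theorem IsLongestIn.unique {J : Set I} {r r' : M.Group} (h : M.IsLongestIn J r)
    (h' : M.IsLongestIn J r') : r = r' :=
  (weakLE_of_subset_leftDescents h'.subset_leftDescents h.1).eq_of_len_le (h.2 _ h'.1)

theorem IsLongestIn.inv_eq {J : Set I} {r : M.Group} (h : M.IsLongestIn J r) : r⁻¹ = r :=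
  IsLongestIn.unique ⟨inv_mem h.1, fun v hv => by rw [len_inv]; exact h.2 v hv⟩ h

theorem IsLongestIn.mul_self {J : Set I} {r : M.Group} (h : M.IsLongestIn J r) : r * r = 1 := by
  nth_rw 1 [← h.inv_eq]
  exact inv_mul_cancel r

theorem IsLongestIn.weakLE_iff {J : Set I} {r w : M.Group} (h : M.IsLongestIn J r) :
    WeakLE r w ↔ J ⊆ M.leftDescents w :=
  ⟨fun hw _ hi => simple_weakLE_iff.mp
    ((simple_weakLE_iff.mpr (h.subset_leftDescents hi)).trans hw),
    fun hw => weakLE_of_subset_leftDescents hw h.1⟩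

theorem IsLongestIn.len_pos {J : Set I} {r : M.Group} (h : M.IsLongestIn J r)
    (hJ : J.Nonempty) : 0 < M.len r := by
  obtain ⟨i, hi⟩ := hJ
  have := h.2 _ (simple_mem_parabolic hi)
  rw [len_simple] at this
  lia

theorem isLongestIn_simple (i : I) : M.IsLongestIn {i} (M.simple i) := by
  refine ⟨simple_mem_parabolic rfl, fun v hv => ?_⟩
  refine (weakLE_of_subset_leftDescents ?_ hv).len_le
  rw [Set.singleton_subset_iff, ← simple_weakLE_iff]
  exact WeakLE.refl _

/-- The simple reflections in a parabolic subgroup are the given ones. -/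
theorem mem_of_simple_mem_parabolic {J : Set I} {i : I} (h : M.simple i ∈ M.parabolic J) :
    i ∈ J := by
  obtain ⟨ω, hω, he, hl⟩ := exists_reduced_word_of_mem_parabolic h
  rw [len_simple, List.length_eq_one_iff] at hl
  obtain ⟨j, rfl⟩ := hl
  rw [CoxeterSystem.wordProd_singleton] at he
  rw [← M.simple_injective he]
  exact hω j (by simp)

theorem mem_of_mem_leftDescents {J : Set I} {w : M.Group} {i : I} (hw : w ∈ M.parabolic J)
    (hi : i ∈ M.leftDescents w) : i ∈ J := by
  obtain ⟨ω, hω, rfl, -⟩ := exists_reduced_word_of_mem_parabolic hw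
  obtain ⟨k, -, h⟩ := M.toCoxeterSystem.exists_eraseIdx_of_isLeftDescent hi
  apply mem_of_simple_mem_parabolic (M := M)
  rw [← (M.parabolic J).mul_mem_cancel_right hw]
  change M.toCoxeterSystem.simple i * _ ∈ _
  rw [h]
  exact wordProd_mem_parabolic fun j hj => hω j (List.mem_of_mem_eraseIdx hj)

theorem IsLongestIn.leftDescents_eq {J : Set I} {r : M.Group} (h : M.IsLongestIn J r) :
    M.leftDescents r = J :=
  Set.Subset.antisymm (fun _ hi => mem_of_mem_leftDescents h.1 hi) h.subset_leftDescents

/-! ### Alternating products -/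

theorem map_altProd {N N' : Type*} [Monoid N] [Monoid N'] (f : N →* N') (n : ℕ) (x y : N) :
    f (altProd n x y) = altProd n (f x) (f y) := by
  induction n generalizing x y with
  | zero => exact map_one f
  | succ n ih => rw [altProd, map_mul, ih, altProd]

theorem altProd_mem {N S : Type*} [Monoid N] [SetLike S N] [SubmonoidClass S N] {s : S} {x y : N}
    (hx : x ∈ s) (hy : y ∈ s) (n : ℕ) : altProd n x y ∈ s := by
  induction n generalizing x y with
  | zero => exact one_mem s
  | succ n ih => exact mul_mem hx (ih hy hx)

theorem altProd_mem_closure {G : Type*} [Group G] (x y : G) (n : ℕ) :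
    altProd n x y ∈ Subgroup.closure {x, y} :=
  altProd_mem (Subgroup.subset_closure (by simp)) (Subgroup.subset_closure (by simp)) n

/-- For involutions, the quotient of the two alternating products of length `n` is the `n`-th
power of the product. -/
theorem altProd_mul_inv_altProd {G : Type*} [Group G] {x y : G} (hx : x * x = 1) (hy : y * y = 1)
    (n : ℕ) : altProd n x y * (altProd n y x)⁻¹ = (x * y) ^ n := by
  induction n generalizing x y with
  | zero => simp [altProd]
  | succ n ih =>
    have hy' : y⁻¹ = y := inv_eq_of_mul_eq_one_right hy
    rw [altProd, altProd, mul_inv_rev, hy', mul_assoc, ← mul_assoc (altProd n y x), ih hy hx,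
      ← mul_assoc, ← mul_pow_mul, mul_assoc, ← pow_succ]

theorem altProd_eq_iff {G : Type*} [Group G] {x y : G} (hx : x * x = 1) (hy : y * y = 1)
    (n : ℕ) : altProd n x y = altProd n y x ↔ orderOf (x * y) ∣ n := by
  rw [orderOf_dvd_iff_pow_eq_one, ← altProd_mul_inv_altProd hx hy, mul_inv_eq_one]

/-- The sum `a + b + a + ⋯` with `n` terms. -/
def altSum : ℕ → ℕ → ℕ → ℕ
  | 0, _, _ => 0
  | n + 1, a, b => a + altSum n b a

theorem altSum_lt_succ {a b : ℕ} (ha : 0 < a) (hb : 0 < b) (n : ℕ) :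
    altSum n a b < altSum (n + 1) a b := by
  induction n generalizing a b with
  | zero => simpa [altSum] using ha
  | succ n ih =>
    rw [altSum, altSum.eq_2 a b (n + 1)]
    exact Nat.add_lt_add_left (ih hb ha) a

theorem le_altSum {a b : ℕ} (ha : 0 < a) (hb : 0 < b) (n : ℕ) : n ≤ altSum n a b := by
  induction n generalizing a b with
  | zero => exact Nat.zero_le _
  | succ n ih =>
    have := ih hb ha
    rw [altSum]
    lia

theorem altSum_one_one (n : ℕ) : altSum n 1 1 = n := by
  induction n with
  | zero => rfl
  | succ n ih => rw [altSum, ih, add_comm]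

/-! ### Dihedral subgroups generated by longest elements -/

/-- Two distinct longest elements `x` and `y` of parabolic subgroups `W_α` and `W_β` such that
the left descents of any element of the subgroup generated by `x` and `y` contain all or none of
`α`, and all or none of `β`. -/
structure IsDihedralPair (α β : Set I) (x y : M.Group) : Prop where
  left : M.IsLongestIn α x
  right : M.IsLongestIn β y
  left_nonempty : α.Nonempty
  right_nonempty : β.Nonempty
  ne : x ≠ y
  left_dichotomy : ∀ w ∈ Subgroup.closure {x, y},
    α ⊆ M.leftDescents w ∨ ∀ i ∈ α, i ∉ M.leftDescents w
  right_dichotomy : ∀ w ∈ Subgroup.closure {x, y},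
    β ⊆ M.leftDescents w ∨ ∀ i ∈ β, i ∉ M.leftDescents w

namespace IsDihedralPair

variable {α β : Set I} {x y : M.Group}

theorem symm (h : IsDihedralPair α β x y) : IsDihedralPair β α y x where
  left := h.right
  right := h.left
  left_nonempty := h.right_nonempty
  right_nonempty := h.left_nonempty
  ne := h.ne.symm
  left_dichotomy := by rw [Set.pair_comm]; exact h.right_dichotomy
  right_dichotomy := by rw [Set.pair_comm]; exact h.left_dichotomy

theorem altProd_mem_parabolic (h : IsDihedralPair α β x y) (n : ℕ) :
    altProd n x y ∈ M.parabolic (α ∪ β) :=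
  altProd_mem (parabolic_mono Set.subset_union_left h.left.1)
    (parabolic_mono Set.subset_union_right h.right.1) n

/-- The alternating products in `x` and `y` have the expected lengths as long as those starting
with `x` and those starting with `y` differ. -/
theorem len_altProd_of_ne (h : IsDihedralPair α β x y) {n : ℕ}
    (hn : ∀ k, 0 < k → k < n → altProd k x y ≠ altProd k y x) :
    M.len (altProd n x y) = altSum n (M.len x) (M.len y) := by
  induction n using Nat.strong_induction_on generalizing α β x y with
  | _ n ih =>
  rcases n with _ | n
  · exact M.len_one
  have hq := ih n n.lt_succ_self h.symm fun k h0 hk => (hn k h0 (by lia)).symm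
  rw [altProd, altSum, ← hq]
  rcases h.left_dichotomy (altProd n y x)
    (by rw [Set.pair_comm]; exact altProd_mem_closure y x n) with hd | hd
  swap
  · exact len_mul_of_disjoint_leftDescents hd h.left.1
  exfalso
  rcases n with _ | n
  · obtain ⟨i, hi⟩ := h.left_nonempty
    exact M.toCoxeterSystem.not_isLeftDescent_one i (hd hi)
  -- Both products of length `n + 1` turn out to be longest elements for `α ∪ β`, hence equal.
  have hp := ih n (by lia) h fun k h0 hk => hn k h0 (by lia)
  have hq' := ih n (by lia) h.symm fun k h0 hk => (hn k h0 (by lia)).symm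
  have hp' := ih (n + 1) (by lia) h fun k h0 hk => hn k h0 (by lia)
  have hβ : β ⊆ M.leftDescents (altProd (n + 1) y x) := by
    rw [← h.right.weakLE_iff, altProd, weakLE_mul_iff, hp]
    exact hq
  have hα' : α ⊆ M.leftDescents (altProd (n + 1) x y) := by
    rw [← h.left.weakLE_iff, altProd, weakLE_mul_iff, hq']
    exact hp'
  have htop {u : M.Group} (hu : u ∈ M.parabolic (α ∪ β)) : WeakLE u (altProd (n + 1) y x) :=
    weakLE_of_subset_leftDescents (Set.union_subset hd hβ) hu
  have hβ' : β ⊆ M.leftDescents (altProd (n + 1) x y) := by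
    refine (h.right_dichotomy _ (altProd_mem_closure x y (n + 1))).resolve_right fun hcon => ?_
    have h1 := len_mul_of_disjoint_leftDescents hcon h.right.1
    have h2 := (htop (mul_mem (parabolic_mono Set.subset_union_right h.right.1)
      (h.altProd_mem_parabolic (n + 1)))).len_le
    have h3 := altSum_lt_succ (h.left.len_pos h.left_nonempty)
      (h.right.len_pos h.right_nonempty) n
    rw [altSum] at hq
    lia
  refine hn (n + 1) (by lia) (by lia) ((htop (h.altProd_mem_parabolic _)).antisymm ?_)
  refine weakLE_of_subset_leftDescents (Set.union_subset hα' hβ') ?_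
  rw [Set.union_comm]
  exact h.symm.altProd_mem_parabolic _

theorem altProd_eq_iff (h : IsDihedralPair α β x y) (n : ℕ) :
    altProd n x y = altProd n y x ↔ orderOf (x * y) ∣ n :=
  CoxeterMatrix.altProd_eq_iff h.left.mul_self h.right.mul_self n

theorem len_altProd (h : IsDihedralPair α β x y) {n : ℕ}
    (hn : orderOf (x * y) = 0 ∨ n ≤ orderOf (x * y)) :
    M.len (altProd n x y) = altSum n (M.len x) (M.len y) := by
  refine h.len_altProd_of_ne fun k h0 hk he => ?_
  rw [h.altProd_eq_iff] at he
  rcases hn with hn | hn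
  · rw [hn, zero_dvd_iff] at he
    lia
  · have := Nat.le_of_dvd h0 he
    lia

theorem orderOf_comm (h : IsDihedralPair α β x y) : orderOf (y * x) = orderOf (x * y) := by
  rw [← orderOf_inv, mul_inv_rev, h.left.inv_eq, h.right.inv_eq]

theorem len_altProd_succ (h : IsDihedralPair α β x y) {n : ℕ}
    (hn : orderOf (x * y) = 0 ∨ n + 1 ≤ orderOf (x * y)) :
    M.len (x * altProd n y x) = M.len x + M.len (altProd n y x) := by
  have h1 := h.len_altProd hn
  have h2 := h.symm.len_altProd (n := n) (by rw [h.orderOf_comm]; lia)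
  rw [h2]
  exact h1

/-- If `x` and `y` have an upper bound in the weak order, then `x * y` has finite order, and the
alternating product of that length is a prefix of every upper bound. -/
theorem orderOf_ne_zero_and_weakLE (h : IsDihedralPair α β x y) {w : M.Group}
    (hx : WeakLE x w) (hy : WeakLE y w) :
    orderOf (x * y) ≠ 0 ∧ WeakLE (altProd (orderOf (x * y)) x y) w := by
  rw [h.left.weakLE_iff] at hx
  rw [h.right.weakLE_iff] at hy
  have key (n : ℕ) : WeakLE (altProd n x y) w :=
    weakLE_of_subset_leftDescents (Set.union_subset hx hy) (h.altProd_mem_parabolic n)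
  refine ⟨fun h0 => ?_, key _⟩
  have h1 := (key (M.len w + 1)).len_le
  rw [h.len_altProd (Or.inl h0)] at h1
  have := le_altSum (h.left.len_pos h.left_nonempty) (h.right.len_pos h.right_nonempty)
    (M.len w + 1)
  lia

end IsDihedralPair

/-- Simple reflections form a dihedral pair, the dichotomies being trivial for singletons. -/
theorem isDihedralPair_simple {i j : I} (hij : i ≠ j) :
    IsDihedralPair {i} {j} (M.simple i) (M.simple j) where
  left := isLongestIn_simple i
  right := isLongestIn_simple j
  left_nonempty := Set.singleton_nonempty i
  right_nonempty := Set.singleton_nonempty j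
  ne := M.simple_injective.ne hij
  left_dichotomy w _ := by simpa using em _
  right_dichotomy w _ := by simpa using em _

theorem orderOf_simple_mul_simple (i j : I) : orderOf (M.simple i * M.simple j) = M i j :=
  M.toCoxeterSystem.orderOf_simple_mul_simple i j

theorem len_altProd_simple {i j : I} (hij : i ≠ j) {n : ℕ} (hn : M i j = 0 ∨ n ≤ M i j) :
    M.len (altProd n (M.simple i) (M.simple j)) = n := by
  rw [(isDihedralPair_simple hij).len_altProd (by rwa [orderOf_simple_mul_simple]), len_simple,
    len_simple, altSum_one_one]

theorem IsAdmissible.nonempty_of_mem {P : Set (Set I)} (hP : M.IsAdmissible P) {α : Set I}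
    (hα : α ∈ P) : α.Nonempty :=
  Set.nonempty_iff_ne_empty.mpr fun h => hP.isPartition.1 (h ▸ hα)

theorem IsAdmissible.isDihedralPair {P : Set (Set I)} (hP : M.IsAdmissible P) {α β : Set I}
    (hα : α ∈ P) (hβ : β ∈ P) (hne : α ≠ β) :
    IsDihedralPair α β (M.longest α) (M.longest β) := by
  have hlα := M.isLongestIn_longest (hP.isSpherical α hα)
  have hlβ := M.isLongestIn_longest (hP.isSpherical β hβ)
  have hdich {γ : Set I} (hγ : γ ∈ P) (w : M.Group)
      (hw : w ∈ Subgroup.closure {M.longest α, M.longest β}) :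
      γ ⊆ M.leftDescents w ∨ ∀ i ∈ γ, i ∉ M.leftDescents w := by
    have hw' : w⁻¹ ∈ Subgroup.closure (M.longest '' P) := by
      refine inv_mem (Subgroup.closure_mono ?_ hw)
      rintro _ (rfl | rfl)
      · exact Set.mem_image_of_mem _ hα
      · exact Set.mem_image_of_mem _ hβ
    refine (hP.ascents_or_descents _ hw' γ hγ).symm.imp (fun h i hi => ?_) fun h i hi => ?_
    · simpa using mem_descents_iff.mp (h hi)
    · simpa using mem_ascents_iff.mp (h hi)
  refine ⟨hlα, hlβ, hP.nonempty_of_mem hα, hP.nonempty_of_mem hβ, ?_,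
    hdich hα, hdich hβ⟩
  intro he
  exact hne (by rw [← hlα.leftDescents_eq, he, hlβ.leftDescents_eq])

/-! ### Reduced words and lifts to the Artin-Tits monoid -/

theorem exists_word_altProd {N : Type*} [Monoid N] (f : I → N) (n : ℕ) (i j : I) :
    ∃ ω : List I, ω.length = n ∧
      M.toCoxeterSystem.wordProd ω = altProd n (M.simple i) (M.simple j) ∧
      (ω.map f).prod = altProd n (f i) (f j) := by
  induction n generalizing i j with
  | zero => exact ⟨[], rfl, CoxeterSystem.wordProd_nil _, rfl⟩
  | succ n ih =>
    obtain ⟨ω, h1, h2, h3⟩ := ih j i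
    exact ⟨i :: ω, by simp [h1], by rw [wordProd_cons, h2, altProd], by simp [h3, altProd]⟩

/-- Matsumoto's theorem: if elements of a monoid satisfy the braid relations, then their product
along a reduced word depends only on the product of the word in the Coxeter group. -/
theorem prod_map_eq_of_reduced {N : Type*} [Monoid N] {f : I → N}
    (hf : ∀ i j, M i j ≠ 0 → altProd (M i j) (f i) (f j) = altProd (M i j) (f j) (f i))
    {ω ω' : List I} (h : M.toCoxeterSystem.wordProd ω = M.toCoxeterSystem.wordProd ω')
    (hω : M.len (M.toCoxeterSystem.wordProd ω) = ω.length)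
    (hω' : M.len (M.toCoxeterSystem.wordProd ω') = ω'.length) :
    (ω.map f).prod = (ω'.map f).prod := by
  induction hn : ω.length generalizing ω ω' with
  | zero =>
    have hn' : ω'.length = 0 := by rw [← hω', ← h, hω, hn]
    rw [List.length_eq_zero_iff] at hn hn'
    rw [hn, hn']
  | succ n ih =>
    have hn' : ω'.length = n + 1 := by rw [← hω', ← h, hω, hn]
    obtain ⟨i, a, rfl⟩ := List.exists_cons_of_length_eq_add_one hn
    obtain ⟨j, b, rfl⟩ := List.exists_cons_of_length_eq_add_one hn'
    rw [List.length_cons] at hn hn' hω hω'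
    have ha := M.len_wordProd_le a
    have hb := M.len_wordProd_le b
    rw [M.wordProd_cons, M.wordProd_cons] at h
    rw [M.wordProd_cons] at hω hω'
    have ha1 := M.len_simple_mul (M.toCoxeterSystem.wordProd a) i
    have hb1 := M.len_simple_mul (M.toCoxeterSystem.wordProd b) j
    rw [List.map_cons, List.map_cons, List.prod_cons, List.prod_cons]
    rcases eq_or_ne i j with rfl | hij
    · rw [ih (mul_left_cancel h) (by lia) (by lia) (by lia)]
    have hi : WeakLE (M.simple i) (M.simple i * M.toCoxeterSystem.wordProd a) := by
      rw [weakLE_mul_iff, len_simple]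
      lia
    have hj : WeakLE (M.simple j) (M.simple i * M.toCoxeterSystem.wordProd a) := by
      rw [h, weakLE_mul_iff, len_simple]
      lia
    obtain ⟨hm0, hm⟩ := (isDihedralPair_simple hij).orderOf_ne_zero_and_weakLE hi hj
    rw [orderOf_simple_mul_simple] at hm0 hm
    have hbraid : altProd (M i j) (M.simple i) (M.simple j) =
        altProd (M i j) (M.simple j) (M.simple i) := by
      rw [(isDihedralPair_simple hij).altProd_eq_iff, orderOf_simple_mul_simple]
    have hfij := hf i j hm0
    have hlen := len_altProd_simple hij (n := M i j) (Or.inr le_rfl)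
    obtain ⟨c, hc, hcl⟩ := M.exists_reduced_word
      ((altProd (M i j) (M.simple i) (M.simple j))⁻¹ *
        (M.simple i * M.toCoxeterSystem.wordProd a))
    have hcm : altProd (M i j) (M.simple i) (M.simple j) * M.toCoxeterSystem.wordProd c =
        M.simple i * M.toCoxeterSystem.wordProd a := by
      rw [hc, mul_inv_cancel_left]
    unfold WeakLE at hm
    rw [← hcl, hlen] at hm
    obtain ⟨m, hm1⟩ := Nat.exists_eq_succ_of_ne_zero hm0
    rw [hm1] at hbraid hfij hm hcm
    obtain ⟨u, hu1, hu2, hu3⟩ := exists_word_altProd (M := M) f m j i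
    obtain ⟨v, hv1, hv2, hv3⟩ := exists_word_altProd (M := M) f m i j
    -- Both given words are compared with words that start with the two sides of the braid
    -- relation and agree afterwards.
    have hau : M.toCoxeterSystem.wordProd a = M.toCoxeterSystem.wordProd (u ++ c) := by
      rw [CoxeterSystem.wordProd_append, hu2]
      apply mul_left_cancel (a := M.simple i)
      rw [← hcm, ← mul_assoc]
      rfl
    have hbv : M.toCoxeterSystem.wordProd b = M.toCoxeterSystem.wordProd (v ++ c) := by
      rw [CoxeterSystem.wordProd_append, hv2]
      apply mul_left_cancel (a := M.simple j)
      rw [← h, ← hcm, ← mul_assoc, hbraid]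
      rfl
    rw [ih hau (by lia) (by rw [← hau, List.length_append]; lia) (by lia),
      ih hbv (by lia) (by rw [← hbv, List.length_append]; lia) (by lia),
      List.map_append, List.map_append, List.prod_append, List.prod_append, hu3, hv3,
      ← mul_assoc, ← mul_assoc]
    exact congrArg (· * _) hfij

theorem altProd_artinGen {i j : I} (h : M i j ≠ 0) :
    altProd (M i j) (M.artinGen i) (M.artinGen j) =
      altProd (M i j) (M.artinGen j) (M.artinGen i) := by
  have h1 : PresentedMonoid.mk M.BraidRel
        (altProd (M i j) (FreeMonoid.of i) (FreeMonoid.of j)) =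
      PresentedMonoid.mk M.BraidRel (altProd (M i j) (FreeMonoid.of j) (FreeMonoid.of i)) :=
    PresentedMonoid.mk_eq_mk_of_rel ⟨i, j, h, rfl, rfl⟩
  rw [map_altProd, map_altProd] at h1
  exact h1

theorem simpleLift_wordProd {ω : List I}
    (hω : M.len (M.toCoxeterSystem.wordProd ω) = ω.length) :
    M.simpleLift (M.toCoxeterSystem.wordProd ω) = (ω.map M.artinGen).prod := by
  have h := (M.toCoxeterSystem.exists_isReduced (M.toCoxeterSystem.wordProd ω)).choose_spec
  exact prod_map_eq_of_reduced (fun i j => altProd_artinGen) h.2.symm h.1 hω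

theorem simpleLift_mul {u v : M.Group} (h : M.len (u * v) = M.len u + M.len v) :
    M.simpleLift (u * v) = M.simpleLift u * M.simpleLift v := by
  obtain ⟨a, rfl, ha⟩ := M.exists_reduced_word u
  obtain ⟨b, rfl, hb⟩ := M.exists_reduced_word v
  rw [simpleLift_wordProd ha.symm, simpleLift_wordProd hb.symm, ← CoxeterSystem.wordProd_append,
    simpleLift_wordProd, List.map_append, List.prod_append]
  rw [CoxeterSystem.wordProd_append, h, List.length_append, ha, hb]

theorem simpleLift_one : M.simpleLift 1 = 1 := by
  have h := simpleLift_wordProd (M := M) (ω := []) (by simp [len_one])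
  simpa using h

theorem simpleLift_simple (i : I) : M.simpleLift (M.simple i) = M.artinGen i := by
  have h := simpleLift_wordProd (M := M) (ω := [i])
    (by rw [CoxeterSystem.wordProd_singleton]; exact M.len_simple i)
  rw [CoxeterSystem.wordProd_singleton] at h
  simpa using h

theorem WeakLE.simpleLift {u w : M.Group} (h : WeakLE u w) :
    M.simpleLift w = M.simpleLift u * M.simpleLift (u⁻¹ * w) := by
  rw [← simpleLift_mul, mul_inv_cancel_left]
  rw [mul_inv_cancel_left]
  exact h.symm

theorem IsDihedralPair.simpleLift_altProd {α β : Set I} {x y : M.Group}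
    (h : IsDihedralPair α β x y) {n : ℕ} (hn : orderOf (x * y) = 0 ∨ n ≤ orderOf (x * y)) :
    M.simpleLift (altProd n x y) = altProd n (M.simpleLift x) (M.simpleLift y) := by
  induction n generalizing α β x y with
  | zero => exact simpleLift_one
  | succ n ih =>
    rw [altProd, altProd, simpleLift_mul (h.len_altProd_succ hn),
      ih h.symm (by rw [h.orderOf_comm]; lia)]

end CoxeterMatrix

/-! ### Division by lifts in the Artin-Tits monoid -/

namespace CoxeterMatrix

variable {I : Type*} {M : CoxeterMatrix I}

theorem artinMonoid_induction {p : M.ArtinMonoid → Prop} (one : p 1)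
    (mul : ∀ i x, p x → p (M.artinGen i * x)) (x : M.ArtinMonoid) : p x := by
  obtain ⟨ω, rfl⟩ := PresentedMonoid.surjective_mk x
  induction ω using FreeMonoid.inductionOn' with
  | one => exact one
  | of_mul i ω ih =>
    rw [map_mul]
    exact mul i _ ih

/-- Multiplication by the lift of `v`, as a transformation of functions which record for each `w`
the quotients by the lift of `w`: if `x = v * y` has the left divisor `w`, then the join `j` of
`w` and `v` divides `x` as well, so that a quotient of `x` by `w` comes from a quotient of `y` by
`v⁻¹ * j`. The values are sets because quotients need not exist. -/
def quotientStep (v : M.Group) : Function.End (M.Group → Set M.ArtinMonoid) :=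
  fun f w => {z | ∃ j, IsJoin w v j ∧ ∃ y ∈ f (v⁻¹ * j), z = M.simpleLift (w⁻¹ * j) * y}

theorem isJoin_one_right_iff {w j : M.Group} : IsJoin w 1 j ↔ j = w := by
  have h : IsJoin w 1 w := ⟨WeakLE.refl w, one_weakLE w, fun z hz _ => hz⟩
  exact ⟨fun hj => hj.unique h, fun hj => hj ▸ h⟩

theorem isJoin_one_left_iff {v j : M.Group} : IsJoin 1 v j ↔ j = v := by
  have h : IsJoin 1 v v := ⟨one_weakLE v, WeakLE.refl v, fun z _ hz => hz⟩
  exact ⟨fun hj => hj.unique h, fun hj => hj ▸ h⟩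

theorem isJoin_self_iff {w j : M.Group} : IsJoin w w j ↔ j = w := by
  have h : IsJoin w w w := ⟨WeakLE.refl w, WeakLE.refl w, fun z _ hz => hz⟩
  exact ⟨fun hj => hj.unique h, fun hj => hj ▸ h⟩

theorem quotientStep_one : quotientStep (1 : M.Group) = 1 := by
  funext f w
  change _ = f w
  ext z
  simp [quotientStep, isJoin_one_right_iff, simpleLift_one]

/-- The transformations `quotientStep` are multiplicative on products with additive lengths,
because joins can be computed in two steps. -/
theorem quotientStep_mul {v v' : M.Group} (h : M.len (v * v') = M.len v + M.len v') :
    quotientStep (v * v') = quotientStep v * quotientStep v' := by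
  funext f w
  change _ = quotientStep v (quotientStep v' f) w
  ext z
  constructor
  · rintro ⟨J, hJ, y, hy, rfl⟩
    obtain ⟨j, hj, hk⟩ := (isJoin_mul_iff h).mp hJ
    refine ⟨j, hj, _, ⟨v⁻¹ * J, hk, y, by rwa [← mul_assoc, ← mul_inv_rev], rfl⟩, ?_⟩
    have hjJ : WeakLE (w⁻¹ * j) (w⁻¹ * J) := by
      rw [hj.1.inv_mul_iff hJ.1]
      exact hj.2.2 J hJ.1 ((weakLE_mul_iff.mpr h).trans hJ.2.1)
    rw [hjJ.simpleLift, mul_assoc]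
    congr 3
    group
  · rintro ⟨j, hj, _, ⟨k, hk, y, hy, rfl⟩, rfl⟩
    have hJ : IsJoin w (v * v') (v * k) :=
      (isJoin_mul_iff h).mpr ⟨j, hj, by rwa [inv_mul_cancel_left]⟩
    refine ⟨v * k, hJ, y, ?_, ?_⟩
    · rwa [mul_inv_rev, mul_assoc, inv_mul_cancel_left]
    · have hjJ : WeakLE (w⁻¹ * j) (w⁻¹ * (v * k)) := by
        rw [hj.1.inv_mul_iff hJ.1]
        exact hj.2.2 _ hJ.1 ((weakLE_mul_iff.mpr h).trans hJ.2.1)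
      rw [hjJ.simpleLift, mul_assoc]
      congr 3
      group

theorem quotientStep_altProd {i j : I} (hij : i ≠ j) {n : ℕ} (hn : M i j = 0 ∨ n ≤ M i j) :
    quotientStep (altProd n (M.simple i) (M.simple j)) =
      altProd n (quotientStep (M.simple i)) (quotientStep (M.simple j)) := by
  induction n generalizing i j with
  | zero => exact quotientStep_one
  | succ n ih =>
    rw [altProd, altProd, quotientStep_mul ((isDihedralPair_simple hij).len_altProd_succ
      (by rwa [orderOf_simple_mul_simple])), ih hij.symm (by rw [M.symmetric]; lia)]

/-- The action of the Artin-Tits monoid by the transformations `quotientStep`. -/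
def quotientAction (M : CoxeterMatrix I) :
    M.ArtinMonoid →* Function.End (M.Group → Set M.ArtinMonoid) :=
  PresentedMonoid.lift (fun i => quotientStep (M.simple i)) (by
    rintro _ _ ⟨i, j, hm, rfl, rfl⟩
    rw [map_altProd, map_altProd]
    simp only [FreeMonoid.lift_eval_of]
    rcases eq_or_ne i j with rfl | hij
    · rfl
    rw [← quotientStep_altProd hij (Or.inr le_rfl),
      ← quotientStep_altProd hij.symm (Or.inr (M.symmetric i j).le),
      ((isDihedralPair_simple hij).altProd_eq_iff _).mpr (orderOf_simple_mul_simple i j).dvd])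

theorem quotientAction_simpleLift (v : M.Group) :
    M.quotientAction (M.simpleLift v) = quotientStep v := by
  have hv : v ∈ M.parabolic Set.univ := by
    rw [parabolic, Set.image_univ]
    exact (Subgroup.eq_top_iff' _).mp M.toCoxeterSystem.subgroup_closure_range_simple v
  refine parabolic_induction (p := fun v => M.quotientAction (M.simpleLift v) = quotientStep v)
    ?_ (fun i _ u _ hd ih => ?_) hv
  · rw [simpleLift_one, map_one, quotientStep_one]
  · have hl : M.len (M.simple i * u) = M.len (M.simple i) + M.len u := by
      rw [notMem_leftDescents] at hd
      rw [hd, len_simple, add_comm]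
    rw [simpleLift_mul hl, map_mul, ih, quotientStep_mul hl, simpleLift_simple]
    rfl

/-- The set of the quotients of `x` on the left by the lift of `w`. -/
def quotients (x : M.ArtinMonoid) : M.Group → Set M.ArtinMonoid :=
  M.quotientAction x fun w => {z | w = 1 ∧ z = 1}

theorem quotients_one (w : M.Group) : quotients (1 : M.ArtinMonoid) w = {z | w = 1 ∧ z = 1} := by
  rw [quotients, map_one]
  rfl

theorem quotients_simpleLift_mul (v : M.Group) (y : M.ArtinMonoid) :
    quotients (M.simpleLift v * y) = quotientStep v (quotients y) := by
  rw [quotients, map_mul, quotientAction_simpleLift]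
  rfl

theorem quotients_artinGen_mul (i : I) (y : M.ArtinMonoid) :
    quotients (M.artinGen i * y) = quotientStep (M.simple i) (quotients y) := by
  rw [← simpleLift_simple, quotients_simpleLift_mul]

theorem eq_mul_of_mem_quotients {x z : M.ArtinMonoid} {w : M.Group} (h : z ∈ quotients x w) :
    x = M.simpleLift w * z := by
  induction x using artinMonoid_induction generalizing w z with
  | one =>
    rw [quotients_one] at h
    obtain ⟨rfl, rfl⟩ := h
    rw [simpleLift_one, one_mul]
  | mul i x ih =>
    rw [quotients_artinGen_mul] at h
    obtain ⟨j, hj, y, hy, rfl⟩ := h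
    rw [ih hy, ← mul_assoc, ← mul_assoc, ← hj.1.simpleLift, ← simpleLift_simple,
      ← hj.2.1.simpleLift]

theorem subsingleton_quotients (x : M.ArtinMonoid) (w : M.Group) :
    (quotients x w).Subsingleton := by
  induction x using artinMonoid_induction generalizing w with
  | one =>
    rw [quotients_one]
    rintro z ⟨-, rfl⟩ z' ⟨-, rfl⟩
    rfl
  | mul i x ih =>
    rw [quotients_artinGen_mul]
    rintro _ ⟨j, hj, y, hy, rfl⟩ _ ⟨j', hj', y', hy', rfl⟩
    obtain rfl := hj.unique hj'
    rw [ih _ hy hy']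

theorem mem_quotients_one (x : M.ArtinMonoid) : x ∈ quotients x 1 := by
  induction x using artinMonoid_induction with
  | one => simp [quotients_one]
  | mul i x ih =>
    rw [quotients_artinGen_mul]
    refine ⟨_, isJoin_one_left_iff.mpr rfl, x, by rwa [inv_mul_cancel], ?_⟩
    rw [inv_one, one_mul, simpleLift_simple]

theorem mem_quotients_iff {x z : M.ArtinMonoid} {w : M.Group} :
    z ∈ quotients x w ↔ x = M.simpleLift w * z := by
  refine ⟨eq_mul_of_mem_quotients, ?_⟩
  rintro rfl
  rw [quotients_simpleLift_mul]
  refine ⟨w, isJoin_self_iff.mpr rfl, z, ?_, ?_⟩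
  · rw [inv_mul_cancel]
    exact mem_quotients_one z
  · rw [inv_mul_cancel, simpleLift_one, one_mul]

theorem simpleLift_mul_left_cancel {w : M.Group} {y z : M.ArtinMonoid}
    (h : M.simpleLift w * y = M.simpleLift w * z) : y = z :=
  subsingleton_quotients _ w (mem_quotients_iff.mpr rfl) (mem_quotients_iff.mpr h)

/-- If the lifts of `u` and `v` left divide `x`, then `u` and `v` have a join in the weak order,
and the lift of the join left divides `x`. -/
theorem exists_isJoin_of_leftDvd {u v : M.Group} {x : M.ArtinMonoid}
    (hu : LeftDvd (M.simpleLift u) x) (hv : LeftDvd (M.simpleLift v) x) :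
    ∃ j, IsJoin u v j ∧ LeftDvd (M.simpleLift j) x := by
  obtain ⟨z, hz⟩ := hu
  obtain ⟨y, rfl⟩ := hv
  rw [← mem_quotients_iff, quotients_simpleLift_mul] at hz
  obtain ⟨j, hj, y', hy', -⟩ := hz
  refine ⟨j, hj, y', ?_⟩
  rw [hj.2.1.simpleLift, mul_assoc, ← mem_quotients_iff.mp hy']

end CoxeterMatrix

/-! ### Degree, divisibility and reversal in the Artin-Tits monoid -/

namespace CoxeterMatrix

variable {I : Type*} {M : CoxeterMatrix I}

/-- The word length of the elements of the Artin-Tits monoid. -/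
def degree (M : CoxeterMatrix I) : M.ArtinMonoid →* Multiplicative ℕ :=
  PresentedMonoid.lift (fun _ => Multiplicative.ofAdd 1) (by
    rintro _ _ ⟨i, j, -, rfl, rfl⟩
    rw [map_altProd, map_altProd]
    rfl)

theorem degree_artinGen (i : I) : M.degree (M.artinGen i) = Multiplicative.ofAdd 1 := rfl

theorem eq_one_of_degree_eq_one {x : M.ArtinMonoid} (h : M.degree x = 1) : x = 1 := by
  induction x using artinMonoid_induction with
  | one => rfl
  | mul i x _ =>
    rw [map_mul, degree_artinGen] at h
    have h' : 1 + (M.degree x).toAdd = 0 := h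
    lia

theorem degree_simpleLift (w : M.Group) :
    M.degree (M.simpleLift w) = Multiplicative.ofAdd (M.len w) := by
  obtain ⟨ω, rfl, hω⟩ := M.exists_reduced_word w
  rw [simpleLift_wordProd hω.symm, map_list_prod, List.map_map, ← hω]
  have : (⇑M.degree ∘ M.artinGen) = fun _ => Multiplicative.ofAdd 1 := rfl
  rw [this, List.map_const', List.prod_replicate]
  simp [← ofAdd_nsmul]

theorem LeftDvd.antisymm {x y : M.ArtinMonoid} (hxy : LeftDvd x y) (hyx : LeftDvd y x) :
    x = y := by
  obtain ⟨a, ha⟩ := hxy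
  obtain ⟨b, hb⟩ := hyx
  have h1 : (M.degree y).toAdd = (M.degree x).toAdd + (M.degree a).toAdd := by
    rw [ha, map_mul, toAdd_mul]
  have h2 : (M.degree x).toAdd = (M.degree y).toAdd + (M.degree b).toAdd := by
    rw [hb, map_mul, toAdd_mul]
  have h3 : M.degree a = 1 := by
    apply Multiplicative.toAdd.injective
    rw [toAdd_one]
    lia
  rw [ha, eq_one_of_degree_eq_one h3, mul_one]

theorem IsRightLcm.unique {x y m m' : M.ArtinMonoid} (h : IsRightLcm x y m)
    (h' : IsRightLcm x y m') : m = m' :=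
  (h.2 m' h'.1.1 h'.1.2).antisymm (h'.2 m h.1.1 h.1.2)

theorem altProd_succ_right {N : Type*} [Monoid N] (n : ℕ) (x y : N) :
    altProd (n + 1) x y = altProd n x y * if Even n then x else y := by
  induction n generalizing x y with
  | zero => simp [altProd]
  | succ n ih =>
    change x * altProd (n + 1) y x = x * altProd n y x * _
    rw [ih, ← mul_assoc]
    by_cases hn : Even n <;> simp [hn, parity_simps]

theorem altProd_op {N : Type*} [Monoid N] (n : ℕ) (x y : N) :
    altProd n (MulOpposite.op x) (MulOpposite.op y) =
      MulOpposite.op (if Even n then altProd n y x else altProd n x y) := by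
  induction n generalizing x y with
  | zero => simp [altProd]
  | succ n ih =>
    rw [altProd, ih, ← MulOpposite.op_mul, altProd_succ_right, altProd_succ_right]
    by_cases hn : Even n <;> simp [hn, parity_simps]

/-- The anti-automorphism of the Artin-Tits monoid that reverses words. -/
def reverse (M : CoxeterMatrix I) : M.ArtinMonoid →* M.ArtinMonoidᵐᵒᵖ :=
  PresentedMonoid.lift (fun i => MulOpposite.op (M.artinGen i)) (by
    rintro _ _ ⟨i, j, hm, rfl, rfl⟩
    rw [map_altProd, map_altProd]
    simp only [FreeMonoid.lift_eval_of]
    rw [altProd_op, altProd_op, altProd_artinGen hm])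

theorem reverse_artinGen (i : I) :
    M.reverse (M.artinGen i) = MulOpposite.op (M.artinGen i) := rfl

theorem unop_reverse_mul (x y : M.ArtinMonoid) :
    (M.reverse (x * y)).unop = (M.reverse y).unop * (M.reverse x).unop := by
  rw [map_mul, MulOpposite.unop_mul]

theorem reverse_reverse (x : M.ArtinMonoid) :
    (M.reverse (M.reverse x).unop).unop = x := by
  induction x using artinMonoid_induction with
  | one => simp
  | mul i x ih =>
    rw [unop_reverse_mul, unop_reverse_mul, ih, reverse_artinGen, MulOpposite.unop_op,
      reverse_artinGen, MulOpposite.unop_op]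

theorem reverse_simpleLift (w : M.Group) :
    M.reverse (M.simpleLift w) = MulOpposite.op (M.simpleLift w⁻¹) := by
  obtain ⟨ω, rfl, hω⟩ := M.exists_reduced_word w
  rw [simpleLift_wordProd hω.symm, ← CoxeterSystem.wordProd_reverse, simpleLift_wordProd (by
    rw [CoxeterSystem.wordProd_reverse, len_inv, List.length_reverse, hω])]
  clear hω
  induction ω with
  | nil => simp
  | cons i ω ih => simp [ih, reverse_artinGen]

theorem leftDvd_reverse_iff {x y : M.ArtinMonoid} :
    LeftDvd (M.reverse x).unop (M.reverse y).unop ↔ RightDvd x y := by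
  constructor
  · rintro ⟨z, hz⟩
    refine ⟨(M.reverse z).unop, ?_⟩
    rw [← reverse_reverse y, hz, unop_reverse_mul, reverse_reverse]
  · rintro ⟨z, rfl⟩
    exact ⟨_, unop_reverse_mul z x⟩

theorem isRightLcm_reverse_iff {x y m : M.ArtinMonoid} :
    IsRightLcm (M.reverse x).unop (M.reverse y).unop (M.reverse m).unop ↔ IsLeftLcm x y m := by
  unfold IsRightLcm IsLeftLcm
  rw [leftDvd_reverse_iff, leftDvd_reverse_iff]
  refine and_congr_right fun _ => ⟨fun h z hx hy => ?_, fun h z hx hy => ?_⟩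
  · rw [← leftDvd_reverse_iff] at hx hy ⊢
    exact h _ hx hy
  · rw [← reverse_reverse z, leftDvd_reverse_iff] at hx hy ⊢
    exact h _ hx hy

/-- A morphism that commutes with reversal respects left lcm's if it respects right lcm's. -/
theorem RespectsRightLcm.respectsLeftLcm {A : Type*} {N : CoxeterMatrix A}
    {φ : N.ArtinMonoid →* M.ArtinMonoid} (h : RespectsRightLcm φ)
    (hφ : ∀ x, (M.reverse (φ x)).unop = φ (N.reverse x).unop) : RespectsLeftLcm φ := by
  have hN (α β : A) (m : N.ArtinMonoid) : IsLeftLcm (N.artinGen α) (N.artinGen β) m ↔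
      IsRightLcm (N.artinGen α) (N.artinGen β) (N.reverse m).unop := by
    rw [← isRightLcm_reverse_iff]
    rfl
  have hM (α β : A) (m : M.ArtinMonoid) :
      IsLeftLcm (φ (N.artinGen α)) (φ (N.artinGen β)) m ↔
      IsRightLcm (φ (N.artinGen α)) (φ (N.artinGen β)) (M.reverse m).unop := by
    rw [← isRightLcm_reverse_iff, hφ, hφ]
    rfl
  refine ⟨h.map_gen_ne_one, fun α β => ?_, fun α β m m' hm hm' => ?_⟩
  · simp only [hN, hM]
    refine Iff.trans ⟨fun ⟨m, hm⟩ => ⟨_, hm⟩, fun ⟨m, hm⟩ => ?_⟩ ((h.exists_iff α β).trans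
      ⟨fun ⟨m, hm⟩ => ?_, fun ⟨m, hm⟩ => ⟨_, hm⟩⟩) <;>
    exact ⟨(reverse _ m).unop, by rwa [reverse_reverse]⟩
  · rw [hN] at hm
    rw [hM] at hm'
    rw [← reverse_reverse m', h.eq_map α β _ _ hm hm', hφ, reverse_reverse]

/-! ### The morphism attached to an admissible partition -/

namespace IsAdmissible

variable {P : Set (Set I)}

theorem isLongestIn (hP : M.IsAdmissible P) (α : P) : M.IsLongestIn α (M.longest (α : Set I)) :=
  M.isLongestIn_longest (hP.isSpherical α α.2)

variable (hP : M.IsAdmissible P)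

/-- The type of an admissible partition. -/
noncomputable def typeMatrix : CoxeterMatrix P where
  M := Matrix.of fun α β => orderOf (M.longest (α : Set I) * M.longest (β : Set I))
  isSymm := by
    ext α β
    rw [Matrix.transpose_apply, Matrix.of_apply, Matrix.of_apply, ← orderOf_inv, mul_inv_rev,
      (hP.isLongestIn α).inv_eq, (hP.isLongestIn β).inv_eq]
  diagonal α := by rw [Matrix.of_apply, (hP.isLongestIn α).mul_self, orderOf_one]
  off_diagonal α β hne h := by
    rw [Matrix.of_apply, orderOf_eq_one_iff, mul_eq_one_iff_eq_inv,
      (hP.isLongestIn β).inv_eq] at h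
    exact (hP.isDihedralPair α.2 β.2 (Subtype.coe_injective.ne hne)).ne h

theorem typeMatrix_apply (α β : P) :
    hP.typeMatrix α β = orderOf (M.longest (α : Set I) * M.longest (β : Set I)) := rfl

theorem altProd_simpleLift {α β : P} (hne : α ≠ β) :
    altProd (hP.typeMatrix α β) (M.simpleLift (M.longest (α : Set I)))
      (M.simpleLift (M.longest (β : Set I))) =
    M.simpleLift (altProd (hP.typeMatrix α β) (M.longest (α : Set I)) (M.longest (β : Set I))) :=
  ((hP.isDihedralPair α.2 β.2 (Subtype.coe_injective.ne hne)).simpleLift_altProd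
    (Or.inr le_rfl)).symm

/-- The morphism of Artin-Tits monoids attached to an admissible partition. -/
noncomputable def artinHom : hP.typeMatrix.ArtinMonoid →* M.ArtinMonoid :=
  PresentedMonoid.lift (fun α : P => M.simpleLift (M.longest (α : Set I))) (by
    rintro _ _ ⟨α, β, -, rfl, rfl⟩
    rw [map_altProd, map_altProd]
    simp only [FreeMonoid.lift_eval_of]
    rcases eq_or_ne α β with rfl | hne
    · rfl
    have hd := hP.isDihedralPair α.2 β.2 (Subtype.coe_injective.ne hne)
    rw [hP.altProd_simpleLift hne, hP.typeMatrix.symmetric α β, hP.altProd_simpleLift hne.symm,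
      (hd.altProd_eq_iff _).mpr]
    rw [typeMatrix_apply, hd.orderOf_comm])

theorem artinHom_artinGen (α : P) :
    hP.artinHom (hP.typeMatrix.artinGen α) = M.simpleLift (M.longest (α : Set I)) := rfl

/-- A common right multiple of the images of two generators is a multiple of the image of the
alternating product of these generators. -/
theorem typeMatrix_ne_zero_and_leftDvd {α β : P} {x : M.ArtinMonoid}
    (hα : LeftDvd (hP.artinHom (hP.typeMatrix.artinGen α)) x)
    (hβ : LeftDvd (hP.artinHom (hP.typeMatrix.artinGen β)) x) :
    hP.typeMatrix α β ≠ 0 ∧ LeftDvd (hP.artinHom (altProd (hP.typeMatrix α β)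
      (hP.typeMatrix.artinGen α) (hP.typeMatrix.artinGen β))) x := by
  rcases eq_or_ne α β with rfl | hne
  · rw [hP.typeMatrix.diagonal]
    refine ⟨one_ne_zero, ?_⟩
    rwa [altProd, altProd, mul_one]
  have hd := hP.isDihedralPair α.2 β.2 (Subtype.coe_injective.ne hne)
  rw [map_altProd, artinHom_artinGen, artinHom_artinGen, hP.altProd_simpleLift hne]
  obtain ⟨j, hj, z, rfl⟩ := exists_isJoin_of_leftDvd hα hβ
  obtain ⟨h0, h1⟩ := hd.orderOf_ne_zero_and_weakLE hj.1 hj.2.1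
  refine ⟨h0, ?_⟩
  rw [h1.simpleLift, mul_assoc]
  exact ⟨_, rfl⟩

theorem artinHom_mul_left_cancel {v : hP.typeMatrix.ArtinMonoid} {y z : M.ArtinMonoid}
    (h : hP.artinHom v * y = hP.artinHom v * z) : y = z := by
  induction v using artinMonoid_induction generalizing y z with
  | one => simpa using h
  | mul α v ih =>
    rw [map_mul, mul_assoc, mul_assoc, artinHom_artinGen] at h
    exact ih (simpleLift_mul_left_cancel h)

theorem degree_artinHom_pos (α : P) :
    0 < (M.degree (hP.artinHom (hP.typeMatrix.artinGen α))).toAdd := by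
  rw [artinHom_artinGen, degree_simpleLift]
  exact (hP.isLongestIn α).len_pos (hP.nonempty_of_mem α.2)

/-- The morphism attached to an admissible partition reflects left divisibility. -/
theorem leftDvd_of_leftDvd_artinHom {v x : hP.typeMatrix.ArtinMonoid}
    (h : LeftDvd (hP.artinHom v) (hP.artinHom x)) : LeftDvd v x := by
  induction hn : (hP.typeMatrix.degree x).toAdd using Nat.strong_induction_on generalizing v x with
  | _ n ih =>
  -- Divisibility by a generator; the general case follows by induction on `v`.
  have gen {α : P} (hα : LeftDvd (hP.artinHom (hP.typeMatrix.artinGen α)) (hP.artinHom x)) :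
      LeftDvd (hP.typeMatrix.artinGen α) x := by
    induction x using artinMonoid_induction with
    | one =>
      obtain ⟨z, hz⟩ := hα
      have h1 := hP.degree_artinHom_pos α
      have h2 := congrArg (fun y => (M.degree y).toAdd) hz
      simp only [map_mul, map_one, toAdd_mul, toAdd_one] at h2
      lia
    | mul β x _ =>
      have hβ : LeftDvd (hP.artinHom (hP.typeMatrix.artinGen β))
          (hP.artinHom (hP.typeMatrix.artinGen β * x)) := ⟨_, map_mul _ _ _⟩
      obtain ⟨h0, z, hz⟩ := hP.typeMatrix_ne_zero_and_leftDvd hβ hα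
      have hbraid := altProd_artinGen h0
      obtain ⟨m, hm⟩ := Nat.exists_eq_succ_of_ne_zero h0
      rw [hm] at hz hbraid
      rw [altProd, map_mul, map_mul, mul_assoc] at hz
      have hdeg : (hP.typeMatrix.degree x).toAdd < n := by
        rw [← hn, map_mul, degree_artinGen, toAdd_mul, toAdd_ofAdd]
        lia
      obtain ⟨y, rfl⟩ := ih _ hdeg ⟨z, hP.artinHom_mul_left_cancel hz⟩ rfl
      refine ⟨altProd m (hP.typeMatrix.artinGen β) (hP.typeMatrix.artinGen α) * y, ?_⟩
      rw [← mul_assoc, ← mul_assoc]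
      exact congrArg (· * y) hbraid
  induction v using artinMonoid_induction with
  | one => exact ⟨x, (one_mul x).symm⟩
  | mul α v _ =>
    obtain ⟨z, hz⟩ := h
    rw [map_mul, mul_assoc] at hz
    obtain ⟨x', rfl⟩ := gen ⟨_, hz⟩
    rw [map_mul] at hz
    have hdeg : (hP.typeMatrix.degree x').toAdd < n := by
      rw [← hn, map_mul, degree_artinGen, toAdd_mul, toAdd_ofAdd]
      lia
    obtain ⟨y, rfl⟩ := ih _ hdeg ⟨z, hP.artinHom_mul_left_cancel hz⟩ rfl
    exact ⟨y, (mul_assoc _ _ _).symm⟩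

theorem artinHom_injective : Function.Injective hP.artinHom := by
  intro x y h
  refine LeftDvd.antisymm (hP.leftDvd_of_leftDvd_artinHom ⟨1, ?_⟩)
    (hP.leftDvd_of_leftDvd_artinHom ⟨1, ?_⟩) <;> rw [h, mul_one]

theorem leftDvd_altProd {α β : P} (h0 : hP.typeMatrix α β ≠ 0) :
    LeftDvd (hP.typeMatrix.artinGen α) (altProd (hP.typeMatrix α β)
      (hP.typeMatrix.artinGen α) (hP.typeMatrix.artinGen β)) ∧
    LeftDvd (hP.typeMatrix.artinGen β) (altProd (hP.typeMatrix α β)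
      (hP.typeMatrix.artinGen α) (hP.typeMatrix.artinGen β)) := by
  have hbraid := altProd_artinGen h0
  obtain ⟨m, hm⟩ := Nat.exists_eq_succ_of_ne_zero h0
  rw [hm] at hbraid ⊢
  exact ⟨⟨_, rfl⟩, ⟨_, hbraid⟩⟩

theorem leftDvd_artinHom {x y : hP.typeMatrix.ArtinMonoid} (h : LeftDvd x y) :
    LeftDvd (hP.artinHom x) (hP.artinHom y) := by
  obtain ⟨z, rfl⟩ := h
  exact ⟨_, map_mul _ _ _⟩

theorem isRightLcm_altProd {α β : P} (h0 : hP.typeMatrix α β ≠ 0) :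
    IsRightLcm (hP.typeMatrix.artinGen α) (hP.typeMatrix.artinGen β)
      (altProd (hP.typeMatrix α β) (hP.typeMatrix.artinGen α) (hP.typeMatrix.artinGen β)) :=
  ⟨hP.leftDvd_altProd h0, fun _ hα hβ => hP.leftDvd_of_leftDvd_artinHom
    (hP.typeMatrix_ne_zero_and_leftDvd (hP.leftDvd_artinHom hα) (hP.leftDvd_artinHom hβ)).2⟩

theorem isRightLcm_artinHom_altProd {α β : P} (h0 : hP.typeMatrix α β ≠ 0) :
    IsRightLcm (hP.artinHom (hP.typeMatrix.artinGen α)) (hP.artinHom (hP.typeMatrix.artinGen β))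
      (hP.artinHom (altProd (hP.typeMatrix α β) (hP.typeMatrix.artinGen α)
        (hP.typeMatrix.artinGen β))) :=
  ⟨(hP.leftDvd_altProd h0).imp hP.leftDvd_artinHom hP.leftDvd_artinHom,
    fun _ hα hβ => (hP.typeMatrix_ne_zero_and_leftDvd hα hβ).2⟩

theorem artinHom_respectsRightLcm : RespectsRightLcm hP.artinHom where
  map_gen_ne_one α h := by
    have := hP.degree_artinHom_pos α
    rw [h, map_one, toAdd_one] at this
    exact lt_irrefl _ this
  exists_iff α β := by
    constructor
    · rintro ⟨m, hm⟩
      exact ⟨_, hP.isRightLcm_artinHom_altProd (hP.typeMatrix_ne_zero_and_leftDvd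
        (hP.leftDvd_artinHom hm.1.1) (hP.leftDvd_artinHom hm.1.2)).1⟩
    · rintro ⟨m, hm⟩
      exact ⟨_, hP.isRightLcm_altProd (hP.typeMatrix_ne_zero_and_leftDvd hm.1.1 hm.1.2).1⟩
  eq_map α β m m' hm hm' := by
    have h0 := (hP.typeMatrix_ne_zero_and_leftDvd hm'.1.1 hm'.1.2).1
    rw [hm.unique (hP.isRightLcm_altProd h0), hm'.unique (hP.isRightLcm_artinHom_altProd h0)]

theorem reverse_artinHom (x : hP.typeMatrix.ArtinMonoid) :
    (M.reverse (hP.artinHom x)).unop = hP.artinHom (hP.typeMatrix.reverse x).unop := by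
  induction x using artinMonoid_induction with
  | one => simp
  | mul α x ih =>
    rw [map_mul, unop_reverse_mul, unop_reverse_mul, map_mul, ih, reverse_artinGen,
      MulOpposite.unop_op, artinHom_artinGen, reverse_simpleLift, (hP.isLongestIn α).inv_eq,
      MulOpposite.unop_op]

theorem mrange_artinHom :
    MonoidHom.mrange hP.artinHom = Submonoid.closure (M.liftedLongest P) := by
  have h : M.liftedLongest P = hP.artinHom '' Set.range hP.typeMatrix.artinGen := by
    rw [← Set.range_comp, liftedLongest, Set.image_eq_range]
    rfl
  rw [h, ← MonoidHom.map_mclosure, MonoidHom.mrange_eq_map]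
  congr 1
  exact (PresentedMonoid.closure_range_of _).symm

end IsAdmissible

end CoxeterMatrix

theorem theorem3p3 {I : Type*} (M : CoxeterMatrix I) (P : Set (Set I))
    (hP : M.IsAdmissible P) :
    ∃ N : CoxeterMatrix P, M.IsTypeOf P N ∧
      ∃ φ : N.ArtinMonoid →* M.ArtinMonoid,
        (∀ α : P, φ (N.artinGen α) = M.simpleLift (M.longest (α : Set I))) ∧
        CoxeterMatrix.RespectsRightLcm φ ∧
        CoxeterMatrix.RespectsLeftLcm φ ∧
        Function.Injective φ ∧
        ∃ e : N.ArtinMonoid ≃* Submonoid.closure (M.liftedLongest P),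
          (∀ x, (e x : M.ArtinMonoid) = φ x) ∧
          e '' Set.range N.artinGen = Subtype.val ⁻¹' M.liftedLongest P := by
  refine ⟨hP.typeMatrix, hP.typeMatrix_apply, hP.artinHom, hP.artinHom_artinGen,
    hP.artinHom_respectsRightLcm, hP.artinHom_respectsRightLcm.respectsLeftLcm
      hP.reverse_artinHom, hP.artinHom_injective,
    (MulEquiv.ofBijective hP.artinHom.mrangeRestrict
      ⟨fun x y h => hP.artinHom_injective (congrArg Subtype.val h),
        hP.artinHom.mrangeRestrict_surjective⟩).trans
      (MulEquiv.submonoidCongr hP.mrange_artinHom), fun x => rfl, ?_⟩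
  ext ⟨y, hy⟩
  constructor
  · rintro ⟨_, ⟨α, rfl⟩, h⟩
    exact ⟨α, α.2, congrArg Subtype.val h⟩
  · rintro ⟨α, hα, h⟩
    exact ⟨_, ⟨⟨α, hα⟩, rfl⟩, Subtype.ext h⟩
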